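/- **Conventions.** Let $A,B$ be C*-algebras with multiplier algebras $M(A),M(B)$. Hilbert C*-modules over $B$ are right modules with $B$-valued inner product linear in the first variable; $\mathcal L(E,F)$ denotes the adjointable maps and $\mathcal L(E)=\mathcal L(E,E)$; $B$ is a Hilbert module over itself with $\langle b,c\rangle=c^*b$. The strict topology on $M(B)$ is given by the seminorms $m\mapsto\|mb\|$, $m\mapsto\|bm\|$ ($b\in B$). A linear map $\rho:A\to M(B)$ is completely positive if $\sum_{i,j}b_j^*\rho(a_j^*a_i)b_i\ge 0$ for all finite families $a_i\in A$, $b_i\in B$; it is strict if it is strictly continuous on bounded sets, and then $\rho(x)$ for $x\in M(A)$ denotes the value at $x$ of its unique linear extension to $M(A)$ that is strictly continuous on bounded sets. **C*-valued weights.** A C*-valued weight from $A$ into $M(B)$ consists of a hereditary cone $\mathcal M_\varphi^+$ in $A^+$ and a linear map $\varphi:\mathcal M_\varphi=\operatorname{span}\mathcal M_\varphi^+\to M(B)$ such that $\sum_{i,j}b_j^*\varphi(a_j^*a_i)b_i\ge0$ for all finite families $a_i\in\mathcal N_\varphi=\{a\in A: a^*a\in\mathcal M_\varphi^+\}$, $b_i\in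 B$. It is densely defined if $\mathcal M_\varphi$ is dense in $A$. A KSGNS-construction $(E,\Lambda,\pi)$ for $\varphi$ consists of a Hilbert C*-module $E$ over $B$, a linear map $\Lambda:\mathcal N_\varphi\to\mathcal L(B,E)$ such that the span of the vectors $\Lambda(a)b$ is dense in $E$ and $\langle\Lambda(a_1)b_1,\Lambda(a_2)b_2\rangle=b_2^*\varphi(a_2^*a_1)b_1$, and a $*$-homomorphism $\pi:A\to\mathcal L(E)$ with $\pi(x)\Lambda(a)=\Lambda(xa)$. Let $\mathcal F_\varphi$ be the set of strict completely positive linear maps $\rho:A\to M(B)$ for which there is $T\in\mathcal L(E)$ with $0\le T\le1$ and $b_2^*\rho(a_2^*a_1)b_1=\langle T\Lambda(a_1)b_1,\Lambda(a_2)b_2\rangle$ for all $a_1,a_2\in\mathcal N_\varphi$, $b_1,b_2\in B$. Put $\mathcal G_\varphi=\{\lambda\rho:\lambda\in[0,1),\ \rho\in\mathcal F_\varphi\}$, directed by: $\rho_1\le\rho_2$ if and only if $\rho_2-\rho_1$ is completely positive. A densely defined $\varphi$ is lower semi-continuous if $\mathcal M_\varphi^+$ is the set of those $x\in A^+$ for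 which the net $(\rho(x))_{\rho\in\mathcal G_\varphi}$ converges strictly in $M(B)$, and the limit is $\varphi(x)$ for every $x\in\mathcal M_\varphi^+$. In that case put $$\overline{\mathcal M}_\varphi^+=\{x\in M(A)^+ : (b^*\rho(x)b)_{\rho\in\mathcal G_\varphi}\text{ converges in }B\text{ for every }b\in B\},\qquad \overline{\mathcal M}_\varphi=\operatorname{span}\overline{\mathcal M}_\varphi^+,$$ and for $x\in\overline{\mathcal M}_\varphi$ let $\varphi(x)$ be the strict limit of $(\rho(x))_{\rho\in\mathcal G_\varphi}$. A truncating net for $\varphi$ is a net $(u_i)_{i\in I}$ in $M(A)$ such that, for every $i$: $\|u_i\|\le1$; $\mathcal N_\varphi u_i\subseteq\mathcal N_\varphi$; there is a (necessarily unique) $S_i\in\mathcal L(E)$ with $\|S_i\|\le1$ and $S_i\Lambda(a)=\Lambda(au_i)$ for $a\in\mathcal N_\varphi$; there is a (necessarily unique) strict completely positive linear map $\rho_i:A\to M(B)$ with $b_2^*\rho_i(a_2^*a_1)b_1=\langle S_i\Lambda(a_1)b_1,S_i\Lambda(a_2)b_2\rangle$ for all $a_1,a_2\in\mathcal N_\varphi$,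 $b_1,b_2\in B$; and moreover $u_i\to1$ strictly and $S_i\to1$ strongly. The weight $\varphi$ is regular if it is densely defined, lower semi-continuous and has a truncating net. **Proposition 8.2.** Let $\varphi$ be a regular C*-valued weight from $A$ into $M(B)$ with KSGNS-construction $(E,\Lambda,\pi)$ and truncating net $(u_i)_{i\in I}$, and let $(\rho_i)_{i\in I}$ be the associated maps. 1. Let $a\in M(A)^+$. Then $a\in\overline{\mathcal M}_\varphi^+$ if and only if the net $(b^*\rho_i(a)b)_{i\in I}$ converges in $B$ for every $b\in B$. 2. Let $a\in\overline{\mathcal M}_\varphi$. Then the strict limit $\varphi(a)=\lim_{\rho\in\mathcal G_\varphi}\rho(a)$ exists, and $(\rho_i(a))_{i\in I}$ converges strictly to $\varphi(a)$. -/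

import Mathlib

open Filter Topology MultiplierAlgebra

noncomputable section

namespace CStarWeights

universe v

/-! ### Multiplier algebras

`𝓜(ℂ, A)` is Mathlib's multiplier algebra of `A`. For `m : 𝓜(ℂ, A)` and `a : A` the product `m a`
is `m.fst a` and the product `a m` is `m.snd a`. So `b₂* m b₁` is `star b₂ * m.fst b₁`. -/

section Multiplier

variable (A : Type*) [NonUnitalCStarAlgebra A]

/-- The usual order of the unital C⋆-algebra `M(A)`. -/
instance : PartialOrder 𝓜(ℂ, A) := CStarAlgebra.spectralOrder _

instance : StarOrderedRing 𝓜(ℂ, A) := CStarAlgebra.spectralOrderedRing _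

/-- The strict topology of `M(A)`: the coarsest one for which the maps `m ↦ m a` and `m ↦ a m` into
`A` (with its norm topology) are continuous for every `a ∈ A`. -/
abbrev strictTopology : TopologicalSpace 𝓜(ℂ, A) :=
  TopologicalSpace.induced (fun m : 𝓜(ℂ, A) => ((fun a => m.fst a, fun a => m.snd a) :
    (A → A) × (A → A))) inferInstance

variable {A}

/-- Strict convergence in `M(A)` of `f` along a filter (for a net: along `atTop`). -/
def StrictTendsto {ι : Type*} (f : ι → 𝓜(ℂ, A)) (l : Filter ι) (m : 𝓜(ℂ, A)) : Prop :=
  Tendsto f l (@nhds _ (strictTopology A) m)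

end Multiplier

/-! ### Strict completely positive maps `A → M(B)` -/

section CP

variable {A B : Type*} [NonUnitalCStarAlgebra A] [NonUnitalCStarAlgebra B]

/-- Complete positivity of a linear map `ρ : A → M(B)`:
`∑ᵢⱼ bⱼ* ρ(aⱼ* aᵢ) bᵢ ≥ 0` in `B` for all finite families in `A` and `B`. -/
def IsCP [PartialOrder B] (ρ : A →ₗ[ℂ] 𝓜(ℂ, B)) : Prop :=
  ∀ (n : ℕ) (a : Fin n → A) (b : Fin n → B),
    0 ≤ ∑ i, ∑ j, star (b j) * (ρ (star (a j) * a i)).fst (b i)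

/-- `ρ : A → M(B)` is strict: on bounded sets it is continuous for the strict topologies
(`A` carries the topology induced by the strict topology of `M(A)`). -/
def IsStrict (ρ : A →ₗ[ℂ] 𝓜(ℂ, B)) : Prop :=
  ∀ r : ℝ, @ContinuousOn A 𝓜(ℂ, B)
    (TopologicalSpace.induced (fun a : A => (a : 𝓜(ℂ, A))) (strictTopology A)) (strictTopology B)
    ρ {a | ‖a‖ ≤ r}

/-- `R : M(A) → M(B)` is a linear extension of `ρ` that is strictly continuous on bounded sets. -/
def IsStrictExtension (ρ : A →ₗ[ℂ] 𝓜(ℂ, B)) (R : 𝓜(ℂ, A) →ₗ[ℂ] 𝓜(ℂ, B)) : Prop :=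
  (∀ a : A, R (a : 𝓜(ℂ, A)) = ρ a) ∧
    ∀ r : ℝ, @ContinuousOn 𝓜(ℂ, A) 𝓜(ℂ, B) (strictTopology A) (strictTopology B) R {x | ‖x‖ ≤ r}

open scoped Classical in
/-- The extension of a strict map `ρ : A → M(B)` to `M(A)`. A strict `ρ` has exactly one linear
extension that is strictly continuous on bounded sets (the unit ball of `A` is strictly dense in
that of `M(A)`, and `M(B)` is strictly complete); for other `ρ` the value is irrelevant. -/
def strictExtension (ρ : A →ₗ[ℂ] 𝓜(ℂ, B)) : 𝓜(ℂ, A) →ₗ[ℂ] 𝓜(ℂ, B) :=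
  if h : ∃ R, IsStrictExtension ρ R then h.choose else 0

end CP

/-! ### Hilbert C⋆-modules

A right Hilbert C⋆-module over `B` is Mathlib's `CStarModule Bᵐᵒᵖ E` on a complete space `E`:
`x b` is `MulOpposite.op b • x`, and the `B`-valued inner product that is linear in its first
variable is `ip B x y`. -/

section HilbertModule

variable (B : Type*) [NonUnitalCStarAlgebra B] [PartialOrder B]

/-- `⟨x, y⟩ ∈ B`, linear in `x`, with `⟨x b, y⟩ = ⟨x, y⟩ b`. -/
def ip {E : Type*} [AddCommGroup E] [Module ℂ E] [SMul Bᵐᵒᵖ E] [Norm E]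
    [CStarModule Bᵐᵒᵖ E] (x y : E) : B :=
  MulOpposite.unop (inner Bᵐᵒᵖ y x)

/-- `B` as a right Hilbert module over itself, with `⟨x, y⟩ = y* x`. -/
instance selfModule [StarOrderedRing B] : CStarModule Bᵐᵒᵖ B where
  inner x y := MulOpposite.op (star x * y)
  inner_add_right := by simp [mul_add]
  inner_self_nonneg {x} := by
    change (0 : B) ≤ star x * x
    exact star_mul_self_nonneg x
  inner_self {x} := by
    rw [MulOpposite.op_eq_zero_iff, CStarRing.star_mul_self_eq_zero_iff]
  inner_op_smul_right {a x y} := by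
    apply MulOpposite.unop_injective
    simp [mul_assoc]
  inner_smul_right_complex {z x y} := by
    apply MulOpposite.unop_injective
    simp [mul_smul_comm]
  star_inner x y := by
    apply MulOpposite.unop_injective
    simp
  norm_eq_sqrt_norm_inner_self x := by
    rw [MulOpposite.norm_op, CStarRing.norm_star_mul_self, Real.sqrt_mul_self (norm_nonneg x)]

variable {E F : Type*}
  [NormedAddCommGroup E] [NormedSpace ℂ E] [SMul Bᵐᵒᵖ E] [CStarModule Bᵐᵒᵖ E]
  [NormedAddCommGroup F] [NormedSpace ℂ F] [SMul Bᵐᵒᵖ F] [CStarModule Bᵐᵒᵖ F]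

/-- `t` belongs to `𝓛(E, F)`, the adjointable maps. -/
def IsAdjointable (t : E →L[ℂ] F) : Prop :=
  ∃ s : F → E, ∀ x y, ip B (t x) y = ip B x (s y)

/-- `T` belongs to `𝓛(E)⁺`: adjointable, and `⟨T x, x⟩ ≥ 0` for every `x`. -/
def IsPositiveOp (T : E →L[ℂ] E) : Prop :=
  IsAdjointable B T ∧ ∀ x, 0 ≤ ip B (T x) x

end HilbertModule

/-! ### C⋆-valued weights -/

section Weight

variable {A : Type*} [NonUnitalCStarAlgebra A] [PartialOrder A] [StarOrderedRing A]

/-- `P` is a hereditary cone in `A⁺`. -/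
structure IsHereditaryCone (P : PointedCone ℝ A) : Prop where
  nonneg : ∀ x ∈ P, 0 ≤ x
  hereditary : ∀ x ∈ P, ∀ y, 0 ≤ y → y ≤ x → y ∈ P

namespace IsHereditaryCone

variable {P : PointedCone ℝ A}

theorem add_sq_mem (hP : IsHereditaryCone P) {a b : A} (ha : star a * a ∈ P)
    (hb : star b * b ∈ P) : star (a + b) * (a + b) ∈ P := by
  have h : (star a * a + star b * b) + (star a * a + star b * b) ∈ P :=
    add_mem (add_mem ha hb) (add_mem ha hb)
  refine hP.hereditary _ h _ (star_mul_self_nonneg _) ?_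
  rw [← sub_nonneg]
  have : (star a * a + star b * b) + (star a * a + star b * b) - star (a + b) * (a + b)
      = star (a - b) * (a - b) := by
    simp only [star_add, star_sub, add_mul, mul_add, sub_mul, mul_sub]
    abel
  rw [this]
  exact star_mul_self_nonneg _

theorem smul_sq_mem {a : A} (ha : star a * a ∈ P) (z : ℂ) :
    star (z • a) * (z • a) ∈ P := by
  have h : star (z • a) * (z • a) = (‖z‖ ^ 2 : ℝ) • (star a * a) := by
    rw [star_smul, smul_mul_smul_comm, RCLike.star_def, RCLike.conj_mul]
    rw [← Complex.coe_smul]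
    norm_cast
  rw [h]
  exact P.smul_mem (by positivity) ha

theorem mul_sq_mem (hP : IsHereditaryCone P) {a : A} (ha : star a * a ∈ P) (x : A) :
    star (x * a) * (x * a) ∈ P := by
  have h : ‖star x * x‖ • (star a * a) ∈ P :=
    P.smul_mem (norm_nonneg _) ha
  refine hP.hereditary _ h _ (star_mul_self_nonneg _) ?_
  have := CStarAlgebra.star_left_conjugate_le_norm_smul (a := a) (b := star x * x)
  rw [star_mul, mul_assoc, ← mul_assoc (star x)]
  rw [mul_assoc] at this
  exact this

/-- The left ideal `N = {a ∈ A | a* a ∈ P}`. -/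
def leftIdeal (hP : IsHereditaryCone P) : Submodule ℂ A where
  carrier := {a | star a * a ∈ P}
  zero_mem' := by simp
  add_mem' := hP.add_sq_mem
  smul_mem' z _ ha := smul_sq_mem ha z

/-- `N* N ⊆ span P`, by polarization. -/
theorem star_mul_mem (hP : IsHereditaryCone P) {a c : A} (ha : a ∈ hP.leftIdeal)
    (hc : c ∈ hP.leftIdeal) : star c * a ∈ Submodule.span ℂ (P : Set A) := by
  have key : ∀ z : ℂ, star (a + z • c) * (a + z • c) ∈ Submodule.span ℂ (P : Set A) := fun z =>
    Submodule.subset_span (hP.leftIdeal.add_mem ha (hP.leftIdeal.smul_mem z hc))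
  have h : star c * a = (4⁻¹ : ℂ) • (star (a + (1 : ℂ) • c) * (a + (1 : ℂ) • c)
      - star (a + (-1 : ℂ) • c) * (a + (-1 : ℂ) • c)
      + Complex.I • (star (a + Complex.I • c) * (a + Complex.I • c))
      - Complex.I • (star (a + (-Complex.I) • c) * (a + (-Complex.I) • c))) := by
    simp only [star_add, star_smul, add_mul, mul_add, smul_mul_assoc, mul_smul_comm, smul_smul,
      smul_add, RCLike.star_def, map_one, map_neg, Complex.conj_I]
    match_scalars <;> norm_num [← mul_assoc, Complex.I_mul_I]
  rw [h]
  exact Submodule.smul_mem _ _ (Submodule.sub_mem _ (Submodule.add_mem _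
    (Submodule.sub_mem _ (key _) (key _)) (Submodule.smul_mem _ _ (key _)))
    (Submodule.smul_mem _ _ (key _)))

end IsHereditaryCone

variable (A) in
/-- A C⋆-valued weight from `A` into `M(B)`: a hereditary cone `P` in `A⁺` and a linear map `φ` from
`M = span P` into `M(B)` such that `∑ᵢⱼ bⱼ* φ(aⱼ* aᵢ) bᵢ ≥ 0` for all finite families
`aᵢ ∈ N = {a | a* a ∈ P}` and `bᵢ ∈ B`. -/
structure CStarWeight (B : Type*) [NonUnitalCStarAlgebra B] [PartialOrder B] where
  /-- `M_φ⁺` -/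
  P : PointedCone ℝ A
  hereditary : IsHereditaryCone P
  /-- `φ : M_φ → M(B)` -/
  toLin : Submodule.span ℂ (P : Set A) →ₗ[ℂ] 𝓜(ℂ, B)
  completely_positive : ∀ (n : ℕ) (a : Fin n → hereditary.leftIdeal) (b : Fin n → B),
    0 ≤ ∑ i, ∑ j, star (b j) *
      (toLin ⟨star (a j : A) * a i, hereditary.star_mul_mem (a i).2 (a j).2⟩).fst (b i)

namespace CStarWeight

variable {B : Type*} [NonUnitalCStarAlgebra B] [PartialOrder B]

/-- `N_φ = {a ∈ A | a* a ∈ M_φ⁺}`. -/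
def N (φ : CStarWeight A B) : Submodule ℂ A := φ.hereditary.leftIdeal

/-- `φ(a₂* a₁) ∈ M(B)` for `a₁, a₂ ∈ N_φ`. -/
def onPair (φ : CStarWeight A B) (a₂ a₁ : φ.N) : 𝓜(ℂ, B) :=
  φ.toLin ⟨star (a₂ : A) * a₁, φ.hereditary.star_mul_mem a₁.2 a₂.2⟩

theorem mul_mem_N (φ : CStarWeight A B) (x : A) (a : φ.N) : x * (a : A) ∈ φ.N :=
  φ.hereditary.mul_sq_mem a.2 x

/-- `M_φ = span M_φ⁺` is norm dense in `A`. -/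
def DenselyDefined (φ : CStarWeight A B) : Prop :=
  Dense (Submodule.span ℂ (φ.P : Set A) : Set A)

end CStarWeight

end Weight

/-! ### KSGNS-constructions and the family of completely positive maps below a weight -/

section KSGNS

variable {A B : Type*} [NonUnitalCStarAlgebra A] [PartialOrder A] [StarOrderedRing A]
  [NonUnitalCStarAlgebra B] [PartialOrder B] [StarOrderedRing B]

/-- A KSGNS-construction `(E, Λ, π)` for `φ`. -/
structure KSGNS (φ : CStarWeight A B) (E : Type*) [NormedAddCommGroup E] [NormedSpace ℂ E]
    [SMul Bᵐᵒᵖ E] [CStarModule Bᵐᵒᵖ E] where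
  /-- `Λ : N_φ → 𝓛(B, E)` -/
  Λ : φ.N →ₗ[ℂ] (B →L[ℂ] E)
  Λ_adjointable : ∀ a, IsAdjointable B (Λ a)
  dense_range : Dense (Submodule.span ℂ {x : E | ∃ a b, Λ a b = x} : Set E)
  ip_Λ : ∀ (a₁ a₂ : φ.N) (b₁ b₂ : B),
    ip B (Λ a₁ b₁) (Λ a₂ b₂) = star b₂ * (φ.onPair a₂ a₁).fst b₁
  /-- The `*`-homomorphism `π : A → 𝓛(E)`; by `π_star`, `π (x*)` is an adjoint of `π x`. -/
  π : A →ₙₐ[ℂ] (E →L[ℂ] E)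
  π_star : ∀ (x : A) (v w : E), ip B (π x v) w = ip B v (π (star x) w)
  π_Λ : ∀ (x : A) (a : φ.N) (b : B), π x (Λ a b) = Λ ⟨x * a, φ.mul_mem_N x a⟩ b

namespace KSGNS

variable {φ : CStarWeight A B} {E : Type*} [NormedAddCommGroup E] [NormedSpace ℂ E]
  [SMul Bᵐᵒᵖ E] [CStarModule Bᵐᵒᵖ E] (K : KSGNS φ E)

/-- `T = T_ρ`, that is `T ∈ 𝓛(E)⁺` and `b₂* ρ(a₂* a₁) b₁ = ⟨T Λ(a₁) b₁, Λ(a₂) b₂⟩` for all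
`a₁, a₂ ∈ N_φ` and `b₁, b₂ ∈ B`. There is at most one such `T`. -/
def IsDensity (ρ : A →ₗ[ℂ] 𝓜(ℂ, B)) (T : E →L[ℂ] E) : Prop :=
  IsPositiveOp B T ∧ ∀ (a₁ a₂ : φ.N) (b₁ b₂ : B),
    star b₂ * (ρ (star (a₂ : A) * a₁)).fst b₁ = ip B (T (K.Λ a₁ b₁)) (K.Λ a₂ b₂)

/-- `𝓗_φ`: the strict completely positive `ρ : A → M(B)` that have a `T_ρ`. -/
def H : Set (A →ₗ[ℂ] 𝓜(ℂ, B)) :=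
  {ρ | IsCP ρ ∧ IsStrict ρ ∧ ∃ T, K.IsDensity ρ T}

/-- `𝓕_φ = {ρ ∈ 𝓗_φ | T_ρ ≤ 1}`. -/
def F : Set (A →ₗ[ℂ] 𝓜(ℂ, B)) :=
  {ρ | ρ ∈ K.H ∧ ∃ T, K.IsDensity ρ T ∧ ∀ x, ip B (T x) x ≤ ip B x x}

/-- `𝓖_φ = {l ρ | l ∈ [0, 1), ρ ∈ 𝓕_φ}`. -/
def G : Set (A →ₗ[ℂ] 𝓜(ℂ, B)) :=
  {ρ | ∃ l : ℝ, 0 ≤ l ∧ l < 1 ∧ ∃ σ ∈ K.F, ρ = (l : ℂ) • σ}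

/-- `𝓖_φ` as the index set of a net. -/
structure Idx where
  map : A →ₗ[ℂ] 𝓜(ℂ, B)
  mem : map ∈ K.G

/-- `𝓖_φ` is ordered by: `ρ ≤ σ` if and only if `σ - ρ` is completely positive. -/
instance : Preorder K.Idx where
  le ρ σ := IsCP (σ.map - ρ.map)
  le_refl ρ n a b := by simp
  le_trans ρ σ τ h₁ h₂ n a b := by
    have h := add_nonneg (h₁ n a b) (h₂ n a b)
    rw [← Finset.sum_add_distrib] at h
    simp only [← Finset.sum_add_distrib, ← mul_add] at h
    convert h using 6 with i _ j _
    simp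

/-- `φ` is lower semi-continuous: `M_φ⁺` is the set of those `x ∈ A⁺` for which the net
`(ρ(x))_{ρ ∈ 𝓖_φ}` is strictly convergent in `M(B)`, and for `x ∈ M_φ⁺` its limit is `φ(x)`. -/
def LowerSemicontinuous : Prop :=
  (∀ x : A, x ∈ φ.P ↔
      0 ≤ x ∧ ∃ m, StrictTendsto (fun ρ : K.Idx => ρ.map x) atTop m) ∧
    ∀ x (hx : x ∈ φ.P), StrictTendsto (fun ρ : K.Idx => ρ.map x) atTop
      (φ.toLin ⟨x, Submodule.subset_span hx⟩)

/-- The net `(uᵢ)` in `M(A)` is truncating for `φ`, with operators `Sᵢ` and strict completely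
positive maps `ρᵢ`. (`Sᵢ` is determined by `uᵢ` because the `Λ(a) b` span a dense subspace, and so
is `ρᵢ` when `φ` is densely defined.) -/
structure IsTruncatingNet {I : Type*} [Preorder I] (u : I → 𝓜(ℂ, A)) (S : I → E →L[ℂ] E)
    (ρ : I → A →ₗ[ℂ] 𝓜(ℂ, B)) : Prop where
  mul_mem : ∀ i, ∀ a ∈ φ.N, (u i).snd a ∈ φ.N
  S_adjointable : ∀ i, IsAdjointable B (S i)
  S_Λ : ∀ i (a : φ.N) (b : B), S i (K.Λ a b) = K.Λ ⟨(u i).snd a, mul_mem i a a.2⟩ b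
  norm_u : ∀ i, ‖u i‖ ≤ 1
  norm_S : ∀ i, ‖S i‖ ≤ 1
  ρ_cp : ∀ i, IsCP (ρ i)
  ρ_strict : ∀ i, IsStrict (ρ i)
  ρ_eq : ∀ i (a₁ a₂ : φ.N) (b₁ b₂ : B),
    star b₂ * (ρ i (star (a₂ : A) * a₁)).fst b₁ = ip B (S i (K.Λ a₁ b₁)) (S i (K.Λ a₂ b₂))
  u_tendsto : StrictTendsto u atTop 1
  S_tendsto : ∀ x, Tendsto (fun i => S i x) atTop (𝓝 x)

/-- `M̄_φ⁺`: the `x ∈ M(A)⁺` such that `(b* ρ(x) b)_{ρ ∈ 𝓖_φ}` converges in `B` for every `b ∈ B`. -/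
def MbarPos : Set 𝓜(ℂ, A) :=
  {x | 0 ≤ x ∧ ∀ b : B, ∃ y, Tendsto
    (fun ρ : K.Idx => star b * (strictExtension ρ.map x).fst b) atTop (𝓝 y)}

/-- `M̄_φ = span M̄_φ⁺`, the domain of the extension of `φ` to `M(A)`. -/
def Mbar : Submodule ℂ 𝓜(ℂ, A) := Submodule.span ℂ K.MbarPos

/-- The value at `x ∈ M̄_φ` of the extension of `φ` to `M(A)`: the strict limit of the net
`(ρ(x))_{ρ ∈ 𝓖_φ}`. -/
def phiBar (x : 𝓜(ℂ, A)) : 𝓜(ℂ, B) :=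
  Classical.epsilon fun m =>
    StrictTendsto (fun ρ : K.Idx => strictExtension ρ.map x) atTop m

end KSGNS

end KSGNS

end CStarWeights

end

/-! Every `ρᵢ` lies in `𝓕_φ`, with density `Sᵢ* Sᵢ`. Conversely, each `σ ∈ 𝓕_φ` with density `T ≤ 1`
satisfies `σ(uᵢ* a uᵢ) ≤ ρᵢ(a)` for `a ≥ 0`: on `a = y* y` with `y ∈ N_φ` this is `⟨T Λ(y uᵢ) b, Λ(y
uᵢ) b⟩ ≤ ⟨Sᵢ Λ(y) b, Sᵢ Λ(y) b⟩`, and strictness passes it to `M(A)` (`strictExtension_conj_le`). As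
`uᵢ* a uᵢ → a` strictly and boundedly, `σ(uᵢ* a uᵢ) → σ(a)`. So the forms `b* ρᵢ(a) b` are bounded
above by any limit along `𝓖_φ` and eventually nearly exceed each `b* σ(a) b`, while elements of
`𝓖_φ` above `(1 - 1/(n+1)) ρᵢ` give the reverse comparison. Norm monotonicity on positive elements
makes the two nets converge together, to the same limit (`tendsto_of_tendsto_idx`,
`tendsto_idx_of_tendsto`).

Strict convergence comes from `‖T x‖² ≤ ‖T‖ ‖⟨T x, x⟩‖` for positive `T`, which upgrades convergence
of forms to convergence of vectors (`exists_strictTendsto_of_monotone`,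
`strictTendsto_zero_of_isPos_fst`). Linearity extends it from `M̄_φ⁺` to its span.

All of this needs `𝓖_φ` to be directed (`isDirectedOrder`). Densities `X, Y ≤ l < 1` have the common
upper bound `1 - ((1-X)⁻¹ + (1-Y)⁻¹ - 1)⁻¹`. Apart from `X + Y` it is a sum of products `T₁ R T₂`
with `T₁, T₂ ∈ {X, Y}` and `R` commuting with `π(A)`. Such a product is the density of the strict
map `x ↦ W₁* R π(x) W₂`, where `Wᵢ b = lim Tᵢ Λ(e) b` along an approximate unit in `N_φ`
(`exists_vector`, `exists_mul_mul`). -/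

noncomputable section

namespace CStarWeights

/-! ### The `B`-valued inner product -/

section InnerProduct

variable {B : Type*} [NonUnitalCStarAlgebra B] [PartialOrder B]
  {E : Type*} [NormedAddCommGroup E] [NormedSpace ℂ E] [SMul Bᵐᵒᵖ E] [CStarModule Bᵐᵒᵖ E]

@[simp] theorem ip_add_left (x y z : E) : ip B (x + y) z = ip B x z + ip B y z := by simp [ip]

@[simp] theorem ip_add_right (x y z : E) : ip B x (y + z) = ip B x y + ip B x z := by simp [ip]

@[simp] theorem ip_sub_left (x y z : E) : ip B (x - y) z = ip B x z - ip B y z := by simp [ip]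

@[simp] theorem ip_sub_right (x y z : E) : ip B x (y - z) = ip B x y - ip B x z := by simp [ip]

@[simp] theorem ip_zero_left (y : E) : ip B 0 y = 0 := by simp [ip]

@[simp] theorem ip_zero_right (x : E) : ip B x 0 = 0 := by simp [ip]

@[simp] theorem ip_smul_left (z : ℂ) (x y : E) : ip B (z • x) y = z • ip B x y := by simp [ip]

@[simp] theorem ip_smul_right (z : ℂ) (x y : E) : ip B x (z • y) = star z • ip B x y := by
  simp [ip]

@[simp] theorem ip_real_smul_left (z : ℝ) (x y : E) : ip B (z • x) y = z • ip B x y := by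
  rw [← Complex.coe_smul, ip_smul_left, Complex.coe_smul]

@[simp] theorem ip_real_smul_right (z : ℝ) (x y : E) : ip B x (z • y) = z • ip B x y := by
  rw [← Complex.coe_smul, ip_smul_right, RCLike.star_def, Complex.conj_ofReal, Complex.coe_smul]

theorem ip_sum_left {ι : Type*} (s : Finset ι) (x : ι → E) (y : E) :
    ip B (∑ i ∈ s, x i) y = ∑ i ∈ s, ip B (x i) y := by
  induction s using Finset.cons_induction with
  | empty => simp
  | cons a s ha ih => simp [ih]

theorem ip_sum_right {ι : Type*} (s : Finset ι) (x : E) (y : ι → E) :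
    ip B x (∑ i ∈ s, y i) = ∑ i ∈ s, ip B x (y i) := by
  induction s using Finset.cons_induction with
  | empty => simp
  | cons a s ha ih => simp [ih]

theorem star_ip (x y : E) : star (ip B x y) = ip B y x := by
  rw [ip, ← MulOpposite.unop_star, CStarModule.star_inner]
  rfl

theorem norm_sq_eq_norm_ip (x : E) : ‖x‖ ^ 2 = ‖ip B x x‖ := by
  rw [CStarModule.norm_sq_eq Bᵐᵒᵖ]
  rfl

theorem eq_of_ip_left {x y : E} (h : ∀ z, ip B x z = ip B y z) : x = y := by
  have h0 : ‖x - y‖ ^ 2 = 0 := by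
    rw [norm_sq_eq_norm_ip (B := B), ip_sub_left, h, sub_self, norm_zero]
  exact sub_eq_zero.1 (norm_eq_zero.1 (pow_eq_zero_iff (two_ne_zero) |>.1 h0))

variable [StarOrderedRing B]

omit [StarOrderedRing B] in
theorem ip_self_nonneg (x : E) : 0 ≤ ip B x x :=
  CStarModule.inner_self_nonneg (A := Bᵐᵒᵖ) (x := x)

theorem norm_ip_le (x y : E) : ‖ip B x y‖ ≤ ‖x‖ * ‖y‖ := by
  rw [mul_comm]
  exact CStarModule.norm_inner_le (A := Bᵐᵒᵖ) E

variable (B E) in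
theorem continuous_ip : Continuous fun p : E × E => ip B p.1 p.2 := by
  have h := CStarModule.continuous_inner (A := Bᵐᵒᵖ) (E := E)
  exact MulOpposite.continuous_unop.comp (h.comp continuous_swap)

theorem tendsto_ip {ι : Type*} {l : Filter ι} {f g : ι → E} {x y : E} (hf : Tendsto f l (𝓝 x))
    (hg : Tendsto g l (𝓝 y)) : Tendsto (fun i => ip B (f i) (g i)) l (𝓝 (ip B x y)) :=
  ((continuous_ip B E).tendsto (x, y)).comp (hf.prodMk_nhds hg)

/-- A vector is determined by its inner products with a set of dense span. -/
theorem eq_of_ip_left_of_dense {D : Set E} (hD : Dense (Submodule.span ℂ D : Set E)) {x y : E}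
    (h : ∀ z ∈ D, ip B x z = ip B y z) : x = y := by
  refine eq_of_ip_left (B := B) fun z => ?_
  have hc : ∀ w : E, Continuous fun z => ip B w z := fun w =>
    (continuous_ip B E).comp (Continuous.prodMk continuous_const continuous_id)
  refine congrFun (Continuous.ext_on hD (hc x) (hc y) fun z hz => ?_) z
  induction hz using Submodule.span_induction with
  | mem z hz => exact h z hz
  | zero => simp
  | add a b _ _ ha hb => simp only [ip_add_right, ha, hb]
  | smul c a _ ha => simp only [ip_smul_right, ha]

end InnerProduct

/-! ### Positive operators -/

section Operators

variable (B : Type*) [NonUnitalCStarAlgebra B] [PartialOrder B]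
  {E : Type*} [NormedAddCommGroup E] [NormedSpace ℂ E] [SMul Bᵐᵒᵖ E] [CStarModule Bᵐᵒᵖ E]

/-- `T* = T` in `𝓛(E)`. -/
def IsSym (T : E →L[ℂ] E) : Prop := ∀ x y, ip B (T x) y = ip B x (T y)

/-- `T ≥ 0` in `𝓛(E)`; the adjoint of `T` is `T`. -/
structure IsPos (T : E →L[ℂ] E) : Prop where
  sym : IsSym B T
  nonneg : ∀ x, 0 ≤ ip B (T x) x

variable {B}

namespace IsSym

variable {S T : E →L[ℂ] E}

theorem one : IsSym B (1 : E →L[ℂ] E) := fun _ _ => rfl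

theorem add (hS : IsSym B S) (hT : IsSym B T) : IsSym B (S + T) := fun x y => by
  simp [hS x y, hT x y]

theorem sub (hS : IsSym B S) (hT : IsSym B T) : IsSym B (S - T) := fun x y => by
  simp [hS x y, hT x y]

theorem smul (hT : IsSym B T) (c : ℝ) : IsSym B (c • T) := fun x y => by
  simp [hT x y]

theorem mul_mul (hT : IsSym B T) (hS : IsSym B S) : IsSym B (S * T * S) := fun x y => by
  simp [hS _ _, hT _ _]

/-- The inverse of a self-adjoint operator is self-adjoint. -/
theorem inverse (hT : IsSym B T) (h : T * S = 1) : IsSym B S := fun x y => by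
  have h' : ∀ x, T (S x) = x := fun x => DFunLike.congr_fun h x
  conv_lhs => rw [← h' y]
  rw [← hT, h']

end IsSym

section

variable {S T : E →L[ℂ] E}

/-- By polarization, an adjointable operator with `⟨T x, x⟩ ≥ 0` is self-adjoint. -/
theorem IsPos.of_nonneg [StarOrderedRing B] (h : ∀ x, 0 ≤ ip B (T x) x) : IsPos B T := by
  refine ⟨fun x y => ?_, h⟩
  have h0 : ∀ x, ip B (T x) x = ip B x (T x) := fun x => by
    rw [← star_ip (T x) x]
    exact (IsSelfAdjoint.of_nonneg (h x)).star_eq.symm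
  -- The vectors `x + y` and `x + i y` give the symmetric and antisymmetric parts of the identity;
  -- their sum is twice the claim.
  have h1 := h0 (x + y)
  have h2 := h0 (x + Complex.I • y)
  simp only [map_add, map_smul, ip_add_left, ip_add_right, ip_smul_left, ip_smul_right, h0 x, h0 y,
    RCLike.star_def, Complex.conj_I] at h1 h2
  have h3 : ip B (T x) y + ip B (T y) x = ip B x (T y) + ip B y (T x) := by
    have := sub_eq_zero.2 h1
    rw [← sub_eq_zero, ← this]
    abel
  have h4 : ip B (T x) y - ip B (T y) x = ip B x (T y) - ip B y (T x) := by
    have := congrArg (fun z => Complex.I • z) (sub_eq_zero.2 h2)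
    simp only [smul_zero] at this
    rw [← sub_eq_zero, ← this]
    simp only [smul_sub, smul_add, smul_smul]
    match_scalars <;> norm_num [← mul_assoc, Complex.I_mul_I]
  have h5 := congrArg₂ (· + ·) h3 h4
  simp only [add_add_sub_cancel, ← two_smul ℂ] at h5
  exact smul_right_injective B (two_ne_zero (α := ℂ)) h5

theorem IsPositiveOp.isPos [StarOrderedRing B] (h : IsPositiveOp B T) : IsPos B T :=
  .of_nonneg h.2

theorem IsPos.isPositiveOp (h : IsPos B T) : IsPositiveOp B T := ⟨⟨T, h.sym⟩, h.nonneg⟩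

end

namespace IsPos

variable [StarOrderedRing B] {R S T : E →L[ℂ] E}

omit [StarOrderedRing B] in
theorem zero : IsPos B (0 : E →L[ℂ] E) := ⟨fun _ _ => by simp, fun _ => by simp⟩

omit [StarOrderedRing B] in
theorem one : IsPos B (1 : E →L[ℂ] E) := ⟨IsSym.one, fun x => ip_self_nonneg x⟩

theorem add (hS : IsPos B S) (hT : IsPos B T) : IsPos B (S + T) :=
  ⟨hS.sym.add hT.sym, fun x => by simpa using add_nonneg (hS.nonneg x) (hT.nonneg x)⟩

theorem smul (hT : IsPos B T) {c : ℝ} (hc : 0 ≤ c) : IsPos B (c • T) :=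
  ⟨hT.sym.smul c, fun x => by simpa using smul_nonneg hc (hT.nonneg x)⟩

omit [StarOrderedRing B] in
theorem mul_mul (hT : IsPos B T) (hS : IsSym B S) : IsPos B (S * T * S) :=
  ⟨hT.sym.mul_mul hS, fun x => by simpa [hS _ x] using hT.nonneg (S x)⟩

omit [StarOrderedRing B] in
theorem inverse (hT : IsPos B T) (h : T * S = 1) : IsPos B S := by
  have hS := hT.sym.inverse h
  have h2 : S * T * S = S := by rw [mul_assoc, h, mul_one]
  rw [← h2]
  exact hT.mul_mul hS

/-- A weak form of `T² ≤ ‖T‖ T`, found without square roots by testing positivity at `x - ‖T‖⁻¹ T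
x`. It is the tool that turns convergence of forms into convergence of vectors. -/
theorem norm_apply_sq_le (hT : IsPos B T) (x : E) : ‖T x‖ ^ 2 ≤ ‖T‖ * ‖ip B (T x) x‖ := by
  rcases (norm_nonneg T).eq_or_lt with h0 | h0
  · have : T = 0 := norm_eq_zero.1 h0.symm
    simp [this]
  set M := ‖T‖ with hM
  have h1 := hT.nonneg (x - M⁻¹ • T x)
  have h2 : ip B (T (x - M⁻¹ • T x)) (x - M⁻¹ • T x) = (ip B (T x) x
      + (M⁻¹ ^ 2) • ip B (T (T x)) (T x)) - (2 * M⁻¹) • ip B (T x) (T x) := by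
    simp only [map_sub, ContinuousLinearMap.map_smul_of_tower, ip_sub_left, ip_sub_right,
      ip_real_smul_left, ip_real_smul_right, hT.sym (T x) x]
    module
  rw [h2, sub_nonneg] at h1
  have h3 := CStarAlgebra.norm_le_norm_of_nonneg_of_le
    (smul_nonneg (by positivity) (ip_self_nonneg (B := B) (T x))) h1
  have h4 : ‖ip B (T (T x)) (T x)‖ ≤ M * ‖T x‖ ^ 2 := by
    refine (norm_ip_le _ _).trans ?_
    rw [sq, ← mul_assoc]
    gcongr
    exact T.le_opNorm _
  have h5 := h3.trans (norm_add_le _ _)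
  rw [norm_smul, norm_smul, ← norm_sq_eq_norm_ip, Real.norm_of_nonneg (by positivity),
    Real.norm_of_nonneg (by positivity)] at h5
  have h6 : M⁻¹ ^ 2 * ‖ip B (T (T x)) (T x)‖ ≤ M⁻¹ * ‖T x‖ ^ 2 := by
    calc _ ≤ M⁻¹ ^ 2 * (M * ‖T x‖ ^ 2) := by gcongr
      _ = _ := by field_simp
  have h7 : M⁻¹ * ‖T x‖ ^ 2 ≤ ‖ip B (T x) x‖ := by linarith
  rwa [inv_mul_le_iff₀ h0] at h7

/-- `0 ≤ T ≤ c` implies `‖T‖ ≤ c`. -/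
theorem norm_le_of_le (hT : IsPos B T) {c : ℝ} (hc : 0 < c)
    (hTc : IsPos B (c • (1 : E →L[ℂ] E) - T)) : ‖T‖ ≤ c := by
  refine T.opNorm_le_bound hc.le fun x => ?_
  -- Positivity at this vector, with `T ≤ c` applied at `x` and at `T x`, leaves `⟨T x, T x⟩ ≤ c²
  -- ⟨x, x⟩`.
  have h1 := hT.nonneg (x - c⁻¹ • T x)
  have h2 : ip B (T (x - c⁻¹ • T x)) (x - c⁻¹ • T x) = (ip B (T x) x
      + (c⁻¹ ^ 2) • ip B (T (T x)) (T x)) - (2 * c⁻¹) • ip B (T x) (T x) := by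
    simp only [map_sub, ContinuousLinearMap.map_smul_of_tower, ip_sub_left, ip_sub_right,
      ip_real_smul_left, ip_real_smul_right, hT.sym (T x) x]
    module
  have h3 : ∀ y, ip B (T y) y ≤ c • ip B y y := fun y => by
    simpa using hTc.nonneg y
  rw [h2, sub_nonneg] at h1
  have h4 := h1.trans (add_le_add (h3 x)
    (smul_le_smul_of_nonneg_left (h3 (T x)) (by positivity : 0 ≤ c⁻¹ ^ 2)))
  have h5 : c⁻¹ • ip B (T x) (T x) ≤ c • ip B x x := by
    have e : (2 * c⁻¹) • ip B (T x) (T x) = c⁻¹ • ip B (T x) (T x) + c⁻¹ • ip B (T x) (T x) := by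
      module
    have e' : c⁻¹ ^ 2 • c • ip B (T x) (T x) = c⁻¹ • ip B (T x) (T x) := by
      rw [smul_smul]
      congr 1
      field_simp
    rw [e, e'] at h4
    exact le_of_add_le_add_right h4
  have h6 := CStarAlgebra.norm_le_norm_of_nonneg_of_le
    (smul_nonneg (by positivity) (ip_self_nonneg (B := B) (T x))) h5
  rw [norm_smul, norm_smul, ← norm_sq_eq_norm_ip, ← norm_sq_eq_norm_ip,
    Real.norm_of_nonneg (by positivity), Real.norm_of_nonneg (by positivity),
    inv_mul_le_iff₀ hc] at h6
  refine le_of_sq_le_sq ?_ (by positivity)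
  calc _ ≤ _ := h6
    _ = _ := by ring

omit [StarOrderedRing B] in
-- Conjugation by `T` raises the exponent by two, whence the induction with step two. The powers are
-- the terms of a Neumann series.
theorem pow (hT : IsPos B T) (n : ℕ) : IsPos B (T ^ n) := by
  induction n using Nat.twoStepInduction with
  | zero => exact one
  | one => simpa using hT
  | more n ih _ =>
    have : T ^ (n + 2) = T * T ^ n * T := by rw [pow_succ, pow_succ']
    rw [this]
    exact ih.mul_mul hT.sym

theorem of_tendsto {ι : Type*} {l : Filter ι} [l.NeBot] {f : ι → E →L[ℂ] E}
    (hf : ∀ i, IsPos B (f i)) (h : ∀ x, Tendsto (fun i => f i x) l (𝓝 (T x))) : IsPos B T :=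
  .of_nonneg fun x => ge_of_tendsto' (tendsto_ip (h x) tendsto_const_nhds)
    fun i => (hf i).nonneg x

/-- A positive contraction is at most `1`. -/
theorem one_sub_of_norm_le_one [CompleteSpace E] (hT : IsPos B T) (h : ‖T‖ ≤ 1) :
    IsPos B (1 - T) := by
  -- For a factor `t < 1` the Neumann series `G = ∑ (t T)ᵏ` converges and is positive, and `1 - t T
  -- = (1 - t T) G (1 - t T)`. Then `t → 1`.
  have key : ∀ n : ℕ, IsPos B (1 - (1 - 1 / ((n : ℝ) + 1)) • T) := fun n => by
    have hn : 1 / ((n : ℝ) + 1) ≤ 1 := by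
      rw [div_le_one (by positivity)]
      linarith [(Nat.cast_nonneg n : (0 : ℝ) ≤ n)]
    have hn' : 0 < 1 / ((n : ℝ) + 1) := by positivity
    set t : ℝ := 1 - 1 / ((n : ℝ) + 1)
    have ht0 : 0 ≤ t := by simp only [t]; linarith
    have hlt : ‖t • T‖ < 1 := by
      rw [norm_smul, Real.norm_of_nonneg ht0]
      have : t * ‖T‖ ≤ t * 1 := by gcongr
      simp only [t] at this ⊢
      linarith
    have hp := hT.smul ht0
    have hs := summable_geometric_of_norm_lt_one hlt
    have hG : IsPos B (∑' k : ℕ, (t • T) ^ k) := by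
      have h1 := hs.hasSum.tendsto_sum_nat
      refine of_tendsto (f := fun m => ∑ k ∈ Finset.range m, (t • T) ^ k) (fun m => ?_)
        (l := atTop) fun x => ?_
      · induction m with
        | zero => simpa using zero
        | succ m ih =>
          rw [Finset.sum_range_succ]
          exact ih.add (hp.pow m)
      · exact ((ContinuousLinearMap.apply ℂ E x).continuous.tendsto _).comp h1
    have := hG.mul_mul (IsSym.one.sub hp.sym)
    rwa [mul_neg_geom_series (t • T) hlt, one_mul] at this
  refine of_tendsto key (l := atTop) fun x => ?_
  have h1 : Tendsto (fun n : ℕ => 1 - 1 / ((n : ℝ) + 1)) atTop (𝓝 (1 - 0)) :=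
    tendsto_const_nhds.sub tendsto_one_div_add_atTop_nhds_zero_nat
  have h2 : Tendsto (fun n : ℕ => x - (1 - 1 / ((n : ℝ) + 1)) • T x) atTop
      (𝓝 (x - (1 - 0 : ℝ) • T x)) := tendsto_const_nhds.sub (h1.smul_const _)
  simpa using h2

/-- Inversion is operator monotone decreasing. -/
theorem inv_sub_inv {P Q P' Q' : E →L[ℂ] E} (hP : IsPos B P) (hQ : IsSym B Q)
    (hPQ : IsPos B (Q - P)) (hPl : P' * P = 1) (hPr : P * P' = 1) (hQl : Q' * Q = 1)
    (hQr : Q * Q' = 1) : IsPos B (P' - Q') := by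
  have hP' := hP.inverse hPr
  have hQ' := hQ.inverse hQr
  -- Both summands are conjugates of positive operators by self-adjoint ones.
  have e : P' - Q' = Q' * (Q - P) * Q' + Q' * ((Q - P) * P' * (Q - P)) * Q' := by
    have h1 : Q' * (Q - P) * Q' = Q' - Q' * P * Q' := by
      rw [mul_sub, sub_mul, hQl, one_mul]
    have h2 : (Q - P) * P' * (Q - P) = Q * P' * Q - Q - Q + P := by
      simp only [sub_mul, mul_sub, hPr, mul_assoc, hPl, mul_one, one_mul]
      abel
    have h3 : Q' * (Q * P' * Q - Q - Q + P) * Q' = P' - Q' - Q' + Q' * P * Q' := by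
      have h4 : Q' * (Q * P' * Q) * Q' = P' := by
        calc Q' * (Q * P' * Q) * Q' = (Q' * Q) * P' * (Q * Q') := by simp only [mul_assoc]
          _ = P' := by rw [hQl, hQr, one_mul, mul_one]
      simp only [mul_add, mul_sub, add_mul, sub_mul, hQl, one_mul] at h4 ⊢
      rw [h4]
    rw [h1, h2, h3]
    abel
  rw [e]
  exact (hPQ.mul_mul hQ').add ((hP'.mul_mul hPQ.sym).mul_mul hQ')

end IsPos

/-- The adjoint of an adjointable operator, as a bounded operator. -/
theorem IsAdjointable.exists_adjoint [StarOrderedRing B] {F : Type*} [NormedAddCommGroup F]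
    [NormedSpace ℂ F] [SMul Bᵐᵒᵖ F] [CStarModule Bᵐᵒᵖ F] {T : E →L[ℂ] F}
    (hT : IsAdjointable B T) :
    ∃ T' : F →L[ℂ] E, (∀ x y, ip B (T x) y = ip B x (T' y)) ∧ ‖T'‖ ≤ ‖T‖ := by
  obtain ⟨s, hs⟩ := hT
  have hs' : ∀ x y, ip B (s y) x = ip B y (T x) := fun x y => by
    rw [← star_ip, ← hs, star_ip]
  let f : F →ₗ[ℂ] E :=
    { toFun := s
      map_add' := fun x y => eq_of_ip_left (B := B) fun z => by simp [hs']
      map_smul' := fun c x => eq_of_ip_left (B := B) fun z => by simp [hs'] }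
  have hb : ∀ y, ‖f y‖ ≤ ‖T‖ * ‖y‖ := fun y => by
    rcases (norm_nonneg (f y)).eq_or_lt with h | h
    · rw [← h]
      positivity
    refine le_of_mul_le_mul_right ?_ h
    calc ‖f y‖ * ‖f y‖ = ‖ip B y (T (f y))‖ := by
          rw [← sq, norm_sq_eq_norm_ip (B := B)]
          exact congrArg _ (hs' _ _)
      _ ≤ ‖y‖ * ‖T (f y)‖ := norm_ip_le _ _
      _ ≤ ‖y‖ * (‖T‖ * ‖f y‖) := by gcongr; exact T.le_opNorm _
      _ = ‖T‖ * ‖y‖ * ‖f y‖ := by ring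
  exact ⟨f.mkContinuous ‖T‖ hb, hs, f.mkContinuous_norm_le (norm_nonneg _) hb⟩

end Operators

/-! ### Invertibility, and common upper bounds strictly below 1. -/

section Operators

variable {B : Type*} [NonUnitalCStarAlgebra B] [PartialOrder B] [StarOrderedRing B]
  {E : Type*} [NormedAddCommGroup E] [NormedSpace ℂ E] [SMul Bᵐᵒᵖ E] [CStarModule Bᵐᵒᵖ E]
  [CompleteSpace E]

namespace IsPos

/-- If `0 ≤ X ≤ l < 1`, then `1 - X` is invertible. -/
theorem isUnit_one_sub {X : E →L[ℂ] E} {l : ℝ} (hX : IsPos B X) (h0 : 0 < l) (h1 : l < 1)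
    (hXl : IsPos B (l • (1 : E →L[ℂ] E) - X)) : IsUnit (1 - X) :=
  isUnit_one_sub_of_norm_lt_one ((hX.norm_le_of_le h0 hXl).trans_lt h1)

/-- If `1 ≤ P ≤ d`, then `P` is invertible. -/
theorem isUnit_of_one_le {P : E →L[ℂ] E} {d : ℝ} (hd : 1 < d) (hP : IsPos B (P - 1))
    (hPd : IsPos B (d • (1 : E →L[ℂ] E) - P)) : IsUnit P := by
  have hd0 : 0 < d := by linarith
  have hd1 : d⁻¹ < 1 := inv_lt_one_of_one_lt₀ hd
  -- `P = d (1 - X)` where `X = 1 - d⁻¹ P` lies between `0` and `1 - d⁻¹ < 1`.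
  have e1 : d⁻¹ • (d • (1 : E →L[ℂ] E) - P) = 1 - d⁻¹ • P := by
    rw [smul_sub, smul_smul, inv_mul_cancel₀ hd0.ne', one_smul]
  have e2 : d⁻¹ • (P - 1) = (1 - d⁻¹) • (1 : E →L[ℂ] E) - (1 - d⁻¹ • P) := by
    rw [smul_sub, sub_smul, one_smul]
    abel
  have h1 : IsPos B (1 - d⁻¹ • P) := e1 ▸ hPd.smul (by positivity)
  have h2 := hP.smul (c := d⁻¹) (by positivity)
  rw [e2] at h2
  have h3 := h1.isUnit_one_sub (by linarith) (by have := inv_pos.2 hd0; linarith) h2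
  rw [sub_sub_cancel] at h3
  have h4 := (IsUnit.mk0 d hd0.ne').map (algebraMap ℝ (E →L[ℂ] E)) |>.mul h3
  rwa [← Algebra.smul_def, smul_smul, mul_inv_cancel₀ hd0.ne', one_smul] at h4

/-- Two positive operators that are bounded by some `l < 1` have a common upper bound `T ≤ l' < 1`,
which is moreover an explicit expression in them, without constant term. -/
theorem exists_upper_bound {X Y : E →L[ℂ] E} {l : ℝ} (h0 : 0 < l) (h1 : l < 1) (hX : IsPos B X)
    (hXl : IsPos B (l • (1 : E →L[ℂ] E) - X)) (hY : IsPos B Y)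
    (hYl : IsPos B (l • (1 : E →L[ℂ] E) - Y)) :
    ∃ (G₁ G₂ Q T : E →L[ℂ] E) (l' : ℝ), IsSym B G₁ ∧ IsSym B G₂ ∧ IsSym B Q ∧
      (∀ Z, Commute Z X → Commute Z Y → Commute Z G₁ ∧ Commute Z G₂ ∧ Commute Z Q) ∧
      T = X + Y + X * (G₁ - G₁ * Q * G₁) * X + Y * (G₂ - G₂ * Q * G₂) * Y
        - X * (G₁ * Q * G₂) * Y - Y * (G₂ * Q * G₁) * X ∧
      IsPos B (T - X) ∧ IsPos B (T - Y) ∧ 0 < l' ∧ l' < 1 ∧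
      IsPos B (l' • (1 : E →L[ℂ] E) - T) := by
  -- With `f(X) = (1 - X)⁻¹ - 1`, which is operator monotone with operator monotone inverse, the
  -- bound is `T = f⁻¹(f(X) + f(Y)) = 1 - (G₁ + G₂ - 1)⁻¹`. From `Gᵢ ≤ (1 - l)⁻¹` one gets `P ≤ d =
  -- 2 (1 - l)⁻¹`, hence `T ≤ 1 - d⁻¹`.
  have inv : ∀ {X : E →L[ℂ] E}, IsPos B X → IsPos B (l • (1 : E →L[ℂ] E) - X) →
      ∃ G, (1 - X) * G = 1 ∧ G * (1 - X) = 1 ∧ IsPos B (1 - X) ∧ IsPos B G ∧ IsPos B (G - 1) ∧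
        IsPos B ((1 - l)⁻¹ • (1 : E →L[ℂ] E) - G) := by
    intro X hX hXl
    obtain ⟨u, hu⟩ := hX.isUnit_one_sub h0 h1 hXl
    have hr : (1 - X) * ↑u⁻¹ = 1 := by rw [← hu, Units.mul_inv]
    have hl : ↑u⁻¹ * (1 - X) = 1 := by rw [← hu, Units.inv_mul]
    have hl0 : 1 - l ≠ 0 := by linarith
    have hp1 : IsPos B ((1 - X) - (1 - l) • (1 : E →L[ℂ] E)) := by
      convert hXl using 1
      rw [sub_smul, one_smul]
      abel
    have hp2 : IsPos B ((1 - l) • (1 : E →L[ℂ] E)) := one.smul (by linarith)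
    have hp : IsPos B (1 - X) := by
      convert hp1.add hp2 using 1
      abel
    refine ⟨↑u⁻¹, hr, hl, hp, hp.inverse hr, ?_, ?_⟩
    · exact inv_sub_inv hp IsSym.one (by rwa [sub_sub_cancel]) hl hr (one_mul 1) (one_mul 1)
    · refine inv_sub_inv hp2 hp.sym hp1 ?_ ?_ hl hr <;>
      simp [hl0]
  obtain ⟨G₁, hr₁, hl₁, hP₁, hG₁, hG₁1, hG₁l⟩ := inv hX hXl
  obtain ⟨G₂, hr₂, hl₂, hP₂, hG₂, hG₂1, hG₂l⟩ := inv hY hYl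
  set P := G₁ + G₂ - 1 with hPdef
  set d := (1 - l)⁻¹ + (1 - l)⁻¹ with hd
  have hld : 1 < (1 - l)⁻¹ := (one_lt_inv₀ (by linarith)).2 (by linarith)
  have hd1 : 1 < d := by linarith
  have hPG₁ : IsPos B (P - G₁) := by
    convert hG₂1 using 1
    rw [hPdef]
    abel
  have hPG₂ : IsPos B (P - G₂) := by
    convert hG₁1 using 1
    rw [hPdef]
    abel
  have hP1 : IsPos B (P - 1) := by
    convert hPG₁.add hG₁1 using 1
    abel
  have hPd : IsPos B (d • (1 : E →L[ℂ] E) - P) := by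
    convert (hG₁l.add hG₂l).add one using 1
    rw [hPdef, hd, add_smul]
    abel
  have hPpos : IsPos B P := by
    convert hP1.add one using 1
    abel
  obtain ⟨u, hu⟩ := isUnit_of_one_le hd1 hP1 hPd
  have hr : P * ↑u⁻¹ = 1 := by rw [← hu, Units.mul_inv]
  have hl : ↑u⁻¹ * P = 1 := by rw [← hu, Units.inv_mul]
  generalize (↑u⁻¹ : E →L[ℂ] E) = Q at hr hl
  have hQ := hPpos.inverse hr
  have comm_inv : ∀ {Z P Q : E →L[ℂ] E}, P * Q = 1 → Q * P = 1 → Commute Z P → Commute Z Q := by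
    intro Z P Q hr hl h
    calc Z * Q = Q * P * (Z * Q) := by rw [hl, one_mul]
      _ = Q * (P * Z) * Q := by simp only [mul_assoc]
      _ = Q * Z * (P * Q) := by rw [← h.eq]; simp only [mul_assoc]
      _ = Q * Z := by rw [hr, mul_one]
  refine ⟨G₁, G₂, Q, 1 - Q, 1 - d⁻¹, hG₁.sym, hG₂.sym, hQ.sym, fun Z hZX hZY => ?_, ?_, ?_, ?_,
    ?_, ?_, ?_⟩
  · have h₁ := comm_inv hr₁ hl₁ ((Commute.one_right Z).sub_right hZX)
    have h₂ := comm_inv hr₂ hl₂ ((Commute.one_right Z).sub_right hZY)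
    exact ⟨h₁, h₂, comm_inv hr hl ((h₁.add_right h₂).sub_right (Commute.one_right Z))⟩
  -- Uses `1 - P⁻¹ = (P - 1) - (P - 1) P⁻¹ (P - 1)` with `P - 1 = X G₁ + Y G₂ = G₁ X + G₂ Y`. After
  -- expansion every term other than `X + Y` begins and ends with `X` or `Y`.
  · have a₁ : X * G₁ = G₁ - 1 := by rw [← hr₁, sub_mul, one_mul, sub_sub_cancel]
    have b₁ : G₁ * X = G₁ - 1 := by rw [← hl₁, mul_sub, mul_one, sub_sub_cancel]
    have a₂ : Y * G₂ = G₂ - 1 := by rw [← hr₂, sub_mul, one_mul, sub_sub_cancel]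
    have b₂ : G₂ * Y = G₂ - 1 := by rw [← hl₂, mul_sub, mul_one, sub_sub_cancel]
    have e : X + Y + X * (G₁ - G₁ * Q * G₁) * X + Y * (G₂ - G₂ * Q * G₂) * Y
        - X * (G₁ * Q * G₂) * Y - Y * (G₂ * Q * G₁) * X
        = X + Y + (X * G₁) * X + (Y * G₂) * Y
          - (X * G₁ + Y * G₂) * Q * (G₁ * X + G₂ * Y) := by
      noncomm_ring
    have f : (G₁ - 1) + (G₂ - 1) = P - 1 := by rw [hPdef]; abel
    have g : X + Y + (G₁ - 1) * X + (G₂ - 1) * Y = P - 1 := by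
      rw [sub_mul, sub_mul, b₁, b₂, one_mul, one_mul, hPdef]
      abel
    rw [e, a₁, b₁, a₂, b₂, f, g]
    simp only [sub_mul, mul_sub, one_mul, mul_one, hr, hl]
    abel
  · have := inv_sub_inv hG₁ hPpos.sym hPG₁ hr₁ hl₁ hl hr
    convert this using 1
    abel
  · have := inv_sub_inv hG₂ hPpos.sym hPG₂ hr₂ hl₂ hl hr
    convert this using 1
    abel
  · have := inv_lt_one_of_one_lt₀ hd1
    linarith
  · have := inv_pos.2 (zero_lt_one.trans hd1)
    linarith
  · have hd0 : d ≠ 0 := by linarith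
    have := inv_sub_inv (Q' := d⁻¹ • (1 : E →L[ℂ] E)) hPpos (IsSym.one.smul d) hPd hl hr
      (by simp [hd0]) (by simp [hd0])
    convert this using 1
    rw [sub_smul, one_smul]
    abel

end IsPos

end Operators

/-! ### Multipliers -/

section Multiplier

variable {A : Type*} [NonUnitalCStarAlgebra A]

theorem eq_of_forall_mul_eq {x y : A} (h : ∀ c, c * x = c * y) : x = y := by
  rw [← sub_eq_zero, ← CStarRing.star_mul_self_eq_zero_iff, mul_sub, h, sub_self]

theorem eq_of_forall_mul_eq_right {x y : A} (h : ∀ c, x * c = y * c) : x = y := by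
  rw [← sub_eq_zero, ← CStarRing.mul_star_self_eq_zero_iff, sub_mul, h, sub_self]

theorem fst_mul (m : 𝓜(ℂ, A)) (a c : A) : m.fst (a * c) = m.fst a * c :=
  eq_of_forall_mul_eq fun d => by rw [← m.central, ← mul_assoc, m.central, mul_assoc]

theorem ext_fst {m n : 𝓜(ℂ, A)} (h : ∀ a, m.fst a = n.fst a) : m = n := by
  refine DoubleCentralizer.ext ℂ A m n (Prod.ext (ContinuousLinearMap.ext h) ?_)
  exact ContinuousLinearMap.ext fun c => eq_of_forall_mul_eq_right fun b => by
    rw [m.central, n.central, h]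

theorem star_fst_mul (m : 𝓜(ℂ, A)) (a b : A) : star (m.fst a) * b = star a * (star m).fst b := by
  rw [DoubleCentralizer.star_fst, ← star_star b, ← star_mul, ← star_mul, star_star, m.central]

theorem norm_fst_apply_le (m : 𝓜(ℂ, A)) (a : A) : ‖m.fst a‖ ≤ ‖m‖ * ‖a‖ := by
  rw [← DoubleCentralizer.norm_fst m]
  exact m.fst.le_opNorm a

theorem norm_snd_apply_le (m : 𝓜(ℂ, A)) (a : A) : ‖m.snd a‖ ≤ ‖m‖ * ‖a‖ := by
  rw [← DoubleCentralizer.norm_snd m]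
  exact m.snd.le_opNorm a

/-- A map `L : A → A` with `x L(y) = R(x) y` for some `R` is linear and bounded. -/
theorem exists_clm_of_central {L R : A → A} (h : ∀ x y, R x * y = x * L y) :
    ∃ T : A →L[ℂ] A, ⇑T = L := by
  let f : A →ₗ[ℂ] A :=
    { toFun := L
      map_add' := fun x y => eq_of_forall_mul_eq fun c => by simp only [mul_add, ← h]
      map_smul' := fun z x => eq_of_forall_mul_eq fun c => by
        simp only [mul_smul_comm, ← h, RingHom.id_apply] }
  -- Closed graph theorem: `c * f y = R c * y` is continuous in `y` for each `c`, and the multiples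
  -- `c * z` determine `z`.
  refine ⟨⟨f, f.continuous_of_seq_closed_graph fun u x y hu hy => ?_⟩, rfl⟩
  refine eq_of_forall_mul_eq fun c => ?_
  have h1 : Tendsto (fun n => c * f (u n)) atTop (𝓝 (c * y)) := hy.const_mul c
  have h2 : Tendsto (fun n => c * f (u n)) atTop (𝓝 (c * f x)) := by
    have : ∀ y, c * f y = R c * y := fun y => (h c y).symm
    simp only [this]
    exact hu.const_mul _
  exact tendsto_nhds_unique h1 h2

/-- A double centralizer from a pair of maps. -/
theorem exists_multiplier {L R : A → A} (h : ∀ x y, R x * y = x * L y) :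
    ∃ m : 𝓜(ℂ, A), (∀ a, m.fst a = L a) ∧ ∀ a, m.snd a = R a := by
  obtain ⟨T, hT⟩ := exists_clm_of_central h
  -- The involution exchanges left and right, so that `R` too becomes a left factor.
  obtain ⟨S, hS⟩ := exists_clm_of_central (L := fun x => star (R (star x)))
    (R := fun x => star (L (star x))) fun x y => by
      rw [← star_star (x * _), star_mul, star_star, h]
      simp
  refine ⟨{ fst := T
            snd := (((starₗᵢ ℂ : A ≃ₗᵢ⋆[ℂ] A) : A →L⋆[ℂ] A).comp S).comp
              ((starₗᵢ ℂ : A ≃ₗᵢ⋆[ℂ] A) : A →L⋆[ℂ] A)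
            central := fun x y => ?_ }, fun a => ?_, fun a => ?_⟩
  · simp [hS, hT, h]
  · simp [hT]
  · simp [hS]

end Multiplier

/-! ### Strict convergence -/

section Strict

variable {A : Type*} [NonUnitalCStarAlgebra A] {ι : Type*} {l : Filter ι} {f g : ι → 𝓜(ℂ, A)}
  {m n : 𝓜(ℂ, A)}

theorem strictTendsto_iff : StrictTendsto f l m ↔
    (∀ a, Tendsto (fun i => (f i).fst a) l (𝓝 (m.fst a))) ∧
      ∀ a, Tendsto (fun i => (f i).snd a) l (𝓝 (m.snd a)) := by
  rw [StrictTendsto, nhds_induced, tendsto_comap_iff, nhds_prod_eq, tendsto_prod_iff']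
  simp only [tendsto_pi_nhds]
  rfl

theorem strictTendsto_coe_iff {f : ι → A} {m : 𝓜(ℂ, A)} :
    StrictTendsto (fun i => (f i : 𝓜(ℂ, A))) l m ↔
    (∀ a, Tendsto (fun i => f i * a) l (𝓝 (m.fst a))) ∧
      ∀ a, Tendsto (fun i => a * f i) l (𝓝 (m.snd a)) :=
  strictTendsto_iff

namespace StrictTendsto

theorem fst (h : StrictTendsto f l m) (a : A) : Tendsto (fun i => (f i).fst a) l (𝓝 (m.fst a)) :=
  (strictTendsto_iff.1 h).1 a

theorem snd (h : StrictTendsto f l m) (a : A) : Tendsto (fun i => (f i).snd a) l (𝓝 (m.snd a)) :=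
  (strictTendsto_iff.1 h).2 a

theorem unique [l.NeBot] (hm : StrictTendsto f l m) (hn : StrictTendsto f l n) : m = n :=
  ext_fst fun a => tendsto_nhds_unique (hm.fst a) (hn.fst a)

theorem comp {κ : Type*} {k : Filter κ} {u : κ → ι} (h : StrictTendsto f l m)
    (hu : Tendsto u k l) : StrictTendsto (fun i => f (u i)) k m :=
  Tendsto.comp h hu

theorem const : StrictTendsto (fun _ => m) l m :=
  strictTendsto_iff.2 ⟨fun _ => tendsto_const_nhds, fun _ => tendsto_const_nhds⟩

theorem add (hf : StrictTendsto f l m) (hg : StrictTendsto g l n) :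
    StrictTendsto (fun i => f i + g i) l (m + n) :=
  strictTendsto_iff.2 ⟨fun a => (hf.fst a).add (hg.fst a), fun a => (hf.snd a).add (hg.snd a)⟩

theorem sub (hf : StrictTendsto f l m) (hg : StrictTendsto g l n) :
    StrictTendsto (fun i => f i - g i) l (m - n) :=
  strictTendsto_iff.2 ⟨fun a => (hf.fst a).sub (hg.fst a), fun a => (hf.snd a).sub (hg.snd a)⟩

theorem smul (hf : StrictTendsto f l m) (z : ℂ) : StrictTendsto (fun i => z • f i) l (z • m) :=
  strictTendsto_iff.2 ⟨fun a => (hf.fst a).const_smul z, fun a => (hf.snd a).const_smul z⟩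

theorem star (hf : StrictTendsto f l m) : StrictTendsto (fun i => star (f i)) l (star m) :=
  strictTendsto_iff.2 ⟨fun a => by simpa using! (hf.snd (Star.star a)).star,
    fun a => by simpa using! (hf.fst (Star.star a)).star⟩

/-- Multiplication is strictly continuous on bounded sets. -/
theorem mul {r : ℝ} (hf : StrictTendsto f l m) (hg : StrictTendsto g l n)
    (hfr : ∀ᶠ i in l, ‖f i‖ ≤ r) (hgr : ∀ᶠ i in l, ‖g i‖ ≤ r) :
    StrictTendsto (fun i => f i * g i) l (m * n) := by
  have aux : ∀ {x : ι → 𝓜(ℂ, A)} {u : ι → A}, (∀ᶠ i in l, ‖x i‖ ≤ r) → Tendsto u l (𝓝 0) →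
      Tendsto (fun i => (x i).fst (u i)) l (𝓝 0) ∧ Tendsto (fun i => (x i).snd (u i)) l (𝓝 0) := by
    intro x u hx hu
    have h0 : Tendsto (fun i => r * ‖u i‖) l (𝓝 0) := by simpa using hu.norm.const_mul r
    constructor
    · refine squeeze_zero_norm' (hx.mono fun i hi => (norm_fst_apply_le _ _).trans ?_) h0
      gcongr
    · refine squeeze_zero_norm' (hx.mono fun i hi => (norm_snd_apply_le _ _).trans ?_) h0
      gcongr
  refine strictTendsto_iff.2 ⟨fun a => ?_, fun a => ?_⟩
  · have h1 := (aux hfr (tendsto_sub_nhds_zero_iff.2 (hg.fst a))).1.add (hf.fst (n.fst a))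
    simpa using! h1
  · have h1 := (aux hgr (tendsto_sub_nhds_zero_iff.2 (hf.snd a))).2.add (hg.snd (m.snd a))
    simpa using! h1

end StrictTendsto

/-- `M(A)` is strictly complete. -/
theorem exists_strictTendsto [l.NeBot] (h₁ : ∀ a, ∃ b, Tendsto (fun i => (f i).fst a) l (𝓝 b))
    (h₂ : ∀ a, ∃ b, Tendsto (fun i => (f i).snd a) l (𝓝 b)) : ∃ m, StrictTendsto f l m := by
  choose L hL using h₁
  choose R hR using h₂
  obtain ⟨m, hm₁, hm₂⟩ := exists_multiplier (L := L) (R := R) fun x y => by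
    refine tendsto_nhds_unique ((hR x).mul_const y) ?_
    simp only [DoubleCentralizer.central]
    exact (hL y).const_mul x
  exact ⟨m, strictTendsto_iff.2 ⟨fun a => hm₁ a ▸ hL a, fun a => hm₂ a ▸ hR a⟩⟩

theorem norm_coe_le (a : A) : ‖(a : 𝓜(ℂ, A))‖ ≤ ‖a‖ := by
  rw [← DoubleCentralizer.norm_fst]
  exact ContinuousLinearMap.opNorm_mul_apply_le ℂ A a

theorem coe_mul (a b : A) : ((a * b : A) : 𝓜(ℂ, A)) = a * b :=
  map_mul (DoubleCentralizer.coeHom (𝕜 := ℂ) (A := A)) a b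

theorem coe_star (a : A) : ((star a : A) : 𝓜(ℂ, A)) = star (a : 𝓜(ℂ, A)) :=
  map_star (DoubleCentralizer.coeHom (𝕜 := ℂ) (A := A)) a

theorem coe_sub (a b : A) : ((a - b : A) : 𝓜(ℂ, A)) = a - b :=
  map_sub (DoubleCentralizer.coeHom (𝕜 := ℂ) (A := A)) a b

/-- Norm convergence implies strict convergence. -/
theorem strictTendsto_coe_of_tendsto {f : ι → A} {a : A} (h : Tendsto f l (𝓝 a)) :
    StrictTendsto (fun i => (f i : 𝓜(ℂ, A))) l a :=
  strictTendsto_coe_iff.2 ⟨fun b => h.mul_const b, fun b => h.const_mul b⟩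

theorem strictTendsto_coe_star_mul {f : ι → A} {r : ℝ}
    (hf : StrictTendsto (fun i => (f i : 𝓜(ℂ, A))) l m)
    (hr : ∀ᶠ i in l, ‖f i‖ ≤ r) :
    StrictTendsto (fun i => ((star (f i) * f i : A) : 𝓜(ℂ, A))) l (star m * m) := by
  have hr' : ∀ᶠ i in l, ‖(f i : 𝓜(ℂ, A))‖ ≤ r := hr.mono fun i hi => (norm_coe_le _).trans hi
  simp only [coe_mul, coe_star]
  exact hf.star.mul hf (by simpa using hr') hr'

end Strict

/-! ### Approximate units -/

section ApproximateUnit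

variable {A : Type*} [NonUnitalCStarAlgebra A]

theorem strictTendsto_of_isApproximateUnit {l : Filter A} (hl : l.IsApproximateUnit)
    (x : 𝓜(ℂ, A)) : StrictTendsto (fun e => ((x.fst e : A) : 𝓜(ℂ, A))) l x := by
  refine strictTendsto_coe_iff.2 ⟨fun a => ?_, fun a => ?_⟩
  · simp only [← fst_mul]
    exact (x.fst.continuous.tendsto _).comp (hl.tendsto_mul_right a)
  · simp only [← x.central]
    exact hl.tendsto_mul_left _

/-- A dense subset of a C⋆-algebra contains a bounded approximate unit. -/
theorem exists_isApproximateUnit_of_dense [PartialOrder A] [StarOrderedRing A] {D : Set A}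
    (hD : Dense D) : ∃ l : Filter A, l.IsApproximateUnit ∧ (∀ᶠ e in l, ‖e‖ ≤ 2) ∧
      ∀ᶠ e in l, e ∈ D := by
  -- For `p.2 ≤ 0` an arbitrary element of `D` is taken, only to make the choice total.
  have h : ∀ p : A × ℝ, ∃ d, d ∈ D ∧ (0 < p.2 → ‖d - p.1‖ < p.2) := fun p => by
    rcases lt_or_ge 0 p.2 with hp | hp
    · obtain ⟨d, hd, hd'⟩ := Metric.dense_iff.1 hD p.1 p.2 hp
      exact ⟨d, hd', fun _ => by rwa [Metric.mem_ball, dist_eq_norm] at hd⟩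
    · obtain ⟨d, hd⟩ := hD.nonempty
      exact ⟨d, hd, fun h => absurd h hp.not_gt⟩
  choose d hd hd' using h
  have hu := CStarAlgebra.increasingApproximateUnit A
  -- Pairs `(e, ε)` with `e` in the canonical approximate unit and `ε → 0⁺`; `d` moves `e` into `D`
  -- by less than `ε`. The bound `2` is `‖e‖ ≤ 1` plus `ε < 1`.
  set k : Filter (A × ℝ) := CStarAlgebra.approximateUnit A ×ˢ 𝓝[>] (0 : ℝ) with hk
  have h1 : Tendsto Prod.fst k (CStarAlgebra.approximateUnit A) := tendsto_fst
  have h2 : Tendsto Prod.snd k (𝓝[>] (0 : ℝ)) := tendsto_snd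
  have h3 : Tendsto Prod.snd k (𝓝 (0 : ℝ)) := h2.mono_right nhdsWithin_le_nhds
  have h4 : ∀ᶠ p in k, 0 < p.2 := h2.eventually self_mem_nhdsWithin
  have h5 : Tendsto (fun p => d p - p.1) k (𝓝 0) :=
    squeeze_zero_norm' (h4.mono fun p hp => (hd' p hp).le) h3
  refine ⟨k.map d, ⟨fun m => ?_, fun m => ?_⟩, ?_, ?_⟩
  · have := (h5.const_mul m).add ((hu.tendsto_mul_left m).comp h1)
    rw [tendsto_map'_iff]
    simpa [Function.comp_def, mul_sub] using this
  · have := (h5.mul_const m).add ((hu.tendsto_mul_right m).comp h1)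
    rw [tendsto_map'_iff]
    simpa [Function.comp_def, sub_mul] using this
  · rw [eventually_map]
    filter_upwards [h4, h3.eventually (gt_mem_nhds one_pos), h1.eventually hu.eventually_norm]
      with p hp hp' hp''
    calc ‖d p‖ = ‖(d p - p.1) + p.1‖ := by rw [sub_add_cancel]
      _ ≤ ‖d p - p.1‖ + ‖p.1‖ := norm_add_le _ _
      _ ≤ 2 := by linarith [hd' p hp]
  · rw [eventually_map]
    exact Eventually.of_forall hd

end ApproximateUnit

/-! ### Strict maps and their extensions -/

section StrictMaps

variable {A B : Type*} [NonUnitalCStarAlgebra A] [NonUnitalCStarAlgebra B]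
  {ρ σ : A →ₗ[ℂ] 𝓜(ℂ, B)} {ι : Type*} {l : Filter ι}

theorem IsStrict.tendsto (hρ : IsStrict ρ) {f : ι → A} {a : A} {r : ℝ}
    (hf : StrictTendsto (fun i => (f i : 𝓜(ℂ, A))) l a) (hr : ∀ᶠ i in l, ‖f i‖ ≤ r) :
    StrictTendsto (fun i => ρ (f i)) l (ρ a) := by
  -- The radius is enlarged so that the limit `a` also lies in the ball.
  have h := hρ (max r ‖a‖) a (le_max_right r ‖a‖)
  refine Tendsto.comp h (tendsto_inf.2 ⟨?_, ?_⟩)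
  · rw [@nhds_induced _ _ (strictTopology A), tendsto_comap_iff]
    exact hf
  · exact tendsto_principal.2 (hr.mono fun i hi => hi.trans (le_max_left _ _))

theorem IsStrict.tendsto_of_tendsto (hρ : IsStrict ρ) {f : ι → A} {a : A}
    (hf : Tendsto f l (𝓝 a)) : StrictTendsto (fun i => ρ (f i)) l (ρ a) :=
  hρ.tendsto (r := ‖a‖ + 1) (strictTendsto_coe_of_tendsto hf)
    ((hf.norm.eventually (gt_mem_nhds (lt_add_one _))).mono fun _ h => h.le)

/-- A test by bounded, strictly convergent filters, which keeps the induced topologies out of later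
arguments. -/
theorem IsStrict.of_tendsto
    (h : ∀ (l : Filter A) (a : A) (r : ℝ), (∀ᶠ x in l, ‖x‖ ≤ r) →
      StrictTendsto (fun x : A => (x : 𝓜(ℂ, A))) l a → StrictTendsto ρ l (ρ a)) :
    IsStrict ρ := by
  intro r a _
  let t : TopologicalSpace A := .induced (fun a : A => (a : 𝓜(ℂ, A))) (strictTopology A)
  refine h (@nhdsWithin A t a _) a r (@eventually_mem_nhdsWithin A t a _)
    (Tendsto.mono_left ?_ (@nhdsWithin_le_nhds A t a _))
  rw [@nhds_induced _ _ (strictTopology A)]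
  exact tendsto_comap

theorem IsStrict.add (hρ : IsStrict ρ) (hσ : IsStrict σ) : IsStrict (ρ + σ) :=
  .of_tendsto fun _ _ _ hr h => (hρ.tendsto h hr).add (hσ.tendsto h hr)

theorem IsStrict.sub (hρ : IsStrict ρ) (hσ : IsStrict σ) : IsStrict (ρ - σ) :=
  .of_tendsto fun _ _ _ hr h => (hρ.tendsto h hr).sub (hσ.tendsto h hr)

theorem IsStrict.smul (hρ : IsStrict ρ) (z : ℂ) : IsStrict (z • ρ) :=
  .of_tendsto fun _ _ _ hr h => (hρ.tendsto h hr).smul z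

theorem IsStrictExtension.tendsto {R : 𝓜(ℂ, A) →ₗ[ℂ] 𝓜(ℂ, B)} (hR : IsStrictExtension ρ R)
    {f : ι → 𝓜(ℂ, A)} {m : 𝓜(ℂ, A)} {r : ℝ} (hf : StrictTendsto f l m)
    (hr : ∀ᶠ i in l, ‖f i‖ ≤ r) : StrictTendsto (fun i => R (f i)) l (R m) :=
  Tendsto.comp (hR.2 (max r ‖m‖) m (le_max_right r ‖m‖)) (tendsto_inf.2 ⟨hf,
    tendsto_principal.2 (hr.mono fun _ hi => hi.trans (le_max_left _ _))⟩)

theorem cauchy_map_of_sub {E : Type*} [NormedAddCommGroup E] [l.NeBot] {f : ι → E}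
    (h : Tendsto (fun p : ι × ι => f p.2 - f p.1) (l ×ˢ l) (𝓝 0)) : Cauchy (l.map f) := by
  rw [cauchy_map_iff', uniformity_eq_comap_nhds_zero, tendsto_comap_iff]
  exact h

/-- A strict map `A → M(B)` has a strict extension to `M(A)`. -/
theorem IsStrict.exists_extension [PartialOrder A] [StarOrderedRing A] (hρ : IsStrict ρ) :
    ∃ R, IsStrictExtension ρ R := by
  obtain ⟨l, hl, hl2, -⟩ := exists_isApproximateUnit_of_dense (A := A) dense_univ
  have := hl.neBot
  have hb : ∀ x : 𝓜(ℂ, A), ∀ᶠ e in l, ‖x.fst e‖ ≤ ‖x‖ * 2 := fun x => hl2.mono fun e he =>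
    (norm_fst_apply_le x e).trans (by gcongr)
  -- The differences `x e' - x e` are bounded and tend strictly to `0`, so `ρ(x e)` is strictly
  -- Cauchy.
  have hlim : ∀ x : 𝓜(ℂ, A), ∃ n, StrictTendsto (fun e => ρ (x.fst e)) l n := fun x => by
    have h1 := strictTendsto_of_isApproximateUnit hl x
    have h2 := (h1.comp (tendsto_snd (f := l))).sub (h1.comp (tendsto_fst (g := l)))
    simp only [← coe_sub, sub_self] at h2
    have h3 : StrictTendsto (fun p : A × A => ρ (x.fst p.2 - x.fst p.1)) (l ×ˢ l) (ρ 0) := by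
      refine hρ.tendsto (r := ‖x‖ * 2 + ‖x‖ * 2) ?_ ?_
      · convert h2
        exact map_zero (DoubleCentralizer.coeHom (𝕜 := ℂ) (A := A))
      · filter_upwards [tendsto_fst.eventually (hb x), tendsto_snd.eventually (hb x)] with p hp hp'
        exact (norm_sub_le _ _).trans (add_le_add hp' hp)
    simp only [map_sub, map_zero] at h3
    refine exists_strictTendsto (fun a => ?_) fun a => ?_
    · refine CompleteSpace.complete (cauchy_map_of_sub ?_)
      simpa using h3.fst a
    · refine CompleteSpace.complete (cauchy_map_of_sub ?_)
      simpa using h3.snd a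
  choose R hR using hlim
  let R' : 𝓜(ℂ, A) →ₗ[ℂ] 𝓜(ℂ, B) :=
    { toFun := R
      map_add' := fun x y => (hR (x + y)).unique (by simpa using (hR x).add (hR y))
      map_smul' := fun z x => (hR (z • x)).unique (by simpa using (hR x).smul z) }
  refine ⟨R', fun a => (hR a).unique (hρ.tendsto_of_tendsto (hl.tendsto_mul_left a)),
    fun r x _ => ?_⟩
  set k : Filter 𝓜(ℂ, A) := @nhdsWithin _ (strictTopology A) x {x | ‖x‖ ≤ r} with hk
  change StrictTendsto R k (R x)
  have hkx : StrictTendsto (fun y => y - x) k (x - x) := by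
    refine StrictTendsto.sub (Tendsto.mono_left tendsto_id ?_) .const
    exact @nhdsWithin_le_nhds _ (strictTopology A) x _
  have hkr : ∀ᶠ y in k, ‖y‖ ≤ r := @eventually_mem_nhdsWithin _ (strictTopology A) x _
  -- Continuity at `x` is reduced to that of `ρ` at `0`: `F` runs through `(y - x) e`, with `e` in
  -- the approximate unit for each `y` near `x`. Smallness of `ρ((y - x) e)` survives the limit in
  -- `e`, which is `R (y - x)`; `ε / 2` absorbs the loss of strict inequality.
  set F : Filter A := k.bind fun y => l.map fun e => (y - x).fst e with hF
  have hFr : ∀ᶠ a in F, ‖a‖ ≤ (r + ‖x‖) * 2 := by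
    rw [hF, eventually_bind]
    filter_upwards [hkr] with y hy
    rw [eventually_map]
    filter_upwards [hb (y - x)] with e he
    refine he.trans ?_
    gcongr
    exact (norm_sub_le _ _).trans (by gcongr)
  have hF0 : StrictTendsto (fun a : A => (a : 𝓜(ℂ, A))) F ((0 : A) : 𝓜(ℂ, A)) := by
    refine strictTendsto_coe_iff.2 ⟨fun c => ?_, fun c => ?_⟩
    · have h1 := hkx.fst c
      simp only [sub_self, DoubleCentralizer.zero_fst, zero_apply] at h1
      rw [Metric.tendsto_nhds] at h1 ⊢
      simp only [dist_zero_right, DoubleCentralizer.coe_fst, ContinuousLinearMap.mul_apply',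
        zero_mul] at h1 ⊢
      intro ε hε
      rw [hF, eventually_bind]
      filter_upwards [h1 ε hε] with y hy
      rw [eventually_map]
      exact (((strictTendsto_of_isApproximateUnit hl (y - x)).fst c).norm).eventually
        (gt_mem_nhds hy)
    · have h1 := hkx.snd c
      simp only [sub_self, DoubleCentralizer.zero_snd, zero_apply] at h1
      rw [Metric.tendsto_nhds] at h1 ⊢
      simp only [dist_zero_right, DoubleCentralizer.coe_snd, ContinuousLinearMap.flip_apply,
        ContinuousLinearMap.mul_apply', mul_zero] at h1 ⊢
      intro ε hε
      rw [hF, eventually_bind]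
      filter_upwards [h1 ε hε] with y hy
      rw [eventually_map]
      exact (((strictTendsto_of_isApproximateUnit hl (y - x)).snd c).norm).eventually
        (gt_mem_nhds hy)
  have h0 := hρ.tendsto hF0 hFr
  rw [map_zero] at h0
  have hsub : ∀ y, R (y - x) = R y - R x := fun y => map_sub R' y x
  refine strictTendsto_iff.2 ⟨fun b => ?_, fun b => ?_⟩
  · have h1 := h0.fst b
    rw [← tendsto_sub_nhds_zero_iff]
    rw [Metric.tendsto_nhds] at h1 ⊢
    simp only [dist_zero_right, DoubleCentralizer.zero_fst, zero_apply] at h1 ⊢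
    intro ε hε
    have h2 := h1 (ε / 2) (half_pos hε)
    rw [hF, eventually_bind] at h2
    filter_upwards [h2] with y hy
    rw [eventually_map] at hy
    have h3 := le_of_tendsto ((hR (y - x)).fst b).norm (hy.mono fun _ h => h.le)
    rw [hsub] at h3
    exact h3.trans_lt (half_lt_self hε)
  · have h1 := h0.snd b
    rw [← tendsto_sub_nhds_zero_iff]
    rw [Metric.tendsto_nhds] at h1 ⊢
    simp only [dist_zero_right, DoubleCentralizer.zero_snd, zero_apply] at h1 ⊢
    intro ε hε
    have h2 := h1 (ε / 2) (half_pos hε)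
    rw [hF, eventually_bind] at h2
    filter_upwards [h2] with y hy
    rw [eventually_map] at hy
    have h3 := le_of_tendsto ((hR (y - x)).snd b).norm (hy.mono fun _ h => h.le)
    rw [hsub] at h3
    exact h3.trans_lt (half_lt_self hε)

theorem IsStrict.isStrictExtension [PartialOrder A] [StarOrderedRing A] (hρ : IsStrict ρ) :
    IsStrictExtension ρ (strictExtension ρ) := by
  rw [strictExtension, dif_pos hρ.exists_extension]
  exact hρ.exists_extension.choose_spec

end StrictMaps

/-! ### The left ideal `N_φ` of a densely defined weight. -/

section Weight

variable {A B : Type*} [NonUnitalCStarAlgebra A] [PartialOrder A] [StarOrderedRing A]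
  [NonUnitalCStarAlgebra B] [PartialOrder B]

/-- `(x a)* (x a) ≤ ‖x* x‖ a* a` for a multiplier `x`. -/
theorem star_fst_mul_fst_le (x : 𝓜(ℂ, A)) (a : A) :
    star (x.fst a) * x.fst a ≤ ‖star x * x‖ • (star a * a) := by
  have h : star x * x ≤ algebraMap ℝ 𝓜(ℂ, A) ‖star x * x‖ :=
    (IsSelfAdjoint.star_mul_self x).le_algebraMap_norm_self
  obtain ⟨y, hy⟩ := CStarAlgebra.nonneg_iff_eq_star_mul_self.1 (sub_nonneg.2 h)
  have h1 := congrArg (fun m : 𝓜(ℂ, A) => star a * m.fst a) hy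
  rw [← sub_nonneg]
  have h2 : ‖star x * x‖ • (star a * a) - star (x.fst a) * x.fst a = star (y.fst a) * y.fst a := by
    rw [star_fst_mul, star_fst_mul]
    rw [Algebra.algebraMap_eq_smul_one, ← Complex.coe_smul] at h1
    simp only [DoubleCentralizer.sub_fst, DoubleCentralizer.smul_fst, DoubleCentralizer.one_fst,
      DoubleCentralizer.mul_fst] at h1
    rw [← Complex.coe_smul, ← mul_smul_comm, ← mul_sub]
    exact h1
  rw [h2]
  exact star_mul_self_nonneg _

namespace CStarWeight

variable (φ : CStarWeight A B)

theorem fst_mem_N (x : 𝓜(ℂ, A)) {a : A} (ha : a ∈ φ.N) : x.fst a ∈ φ.N :=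
  φ.hereditary.hereditary _ (φ.P.smul_mem (norm_nonneg _) ha) _ (star_mul_self_nonneg _)
    (star_fst_mul_fst_le x a)

variable {φ}

/-- For `x = y* y ∈ M_φ⁺` one has `x² = y* (y y*) y ≤ ‖y y*‖ x`, so `M_φ⁺ ⊆ N_φ` by heredity, and
hence `M_φ ⊆ N_φ`. -/
theorem DenselyDefined.dense_N (hφ : φ.DenselyDefined) : Dense (φ.N : Set A) := by
  refine Dense.mono ?_ hφ
  refine Submodule.span_le.2 fun x hx => ?_
  obtain ⟨y, rfl⟩ := CStarAlgebra.nonneg_iff_eq_star_mul_self.1 (φ.hereditary.nonneg _ hx)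
  have h := CStarAlgebra.star_left_conjugate_le_norm_smul (a := y) (b := y * star y)
    (hb := .mul_star_self y)
  refine φ.hereditary.hereditary _ (φ.P.smul_mem (norm_nonneg (y * star y)) hx) _
    (star_mul_self_nonneg _) ?_
  convert h using 1
  simp [mul_assoc]

/-- A bounded approximate unit in `N_φ`. -/
theorem DenselyDefined.exists_isApproximateUnit (hφ : φ.DenselyDefined) :
    ∃ l : Filter φ.N, (l.map fun e : φ.N => (e : A)).IsApproximateUnit ∧
      ∀ᶠ e : φ.N in l, ‖(e : A)‖ ≤ 2 := by
  obtain ⟨l, hl, hl2, hlN⟩ := exists_isApproximateUnit_of_dense hφ.dense_N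
  refine ⟨l.comap (fun e : φ.N => (e : A)), ?_, tendsto_comap.eventually hl2⟩
  rwa [map_comap_of_mem]
  change Set.range Subtype.val ∈ l
  rw [Subtype.range_coe]
  exact hlN

end CStarWeight

end Weight

/-! ### Densities, continuity of `π`, and the implementing maps `W`. -/

namespace KSGNS

variable {A B : Type*} [NonUnitalCStarAlgebra A] [PartialOrder A] [StarOrderedRing A]
  [NonUnitalCStarAlgebra B] [PartialOrder B] [StarOrderedRing B]
  {φ : CStarWeight A B} {E : Type*} [NormedAddCommGroup E] [NormedSpace ℂ E]
  [SMul Bᵐᵒᵖ E] [CStarModule Bᵐᵒᵖ E] (K : KSGNS φ E)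

/-- `b₂* κ(a₂* a₁) b₁ = ⟨T Λ(a₁) b₁, Λ(a₂) b₂⟩`, without positivity of `T`. -/
def HasDensity (κ : A →ₗ[ℂ] 𝓜(ℂ, B)) (T : E →L[ℂ] E) : Prop :=
  ∀ (a₁ a₂ : φ.N) (b₁ b₂ : B),
    star b₂ * (κ (star (a₂ : A) * a₁)).fst b₁ = ip B (T (K.Λ a₁ b₁)) (K.Λ a₂ b₂)

variable {K}

namespace HasDensity

variable {κ κ' : A →ₗ[ℂ] 𝓜(ℂ, B)} {T T' : E →L[ℂ] E}

theorem add (h : K.HasDensity κ T) (h' : K.HasDensity κ' T') : K.HasDensity (κ + κ') (T + T') :=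
  fun a₁ a₂ b₁ b₂ => by
    simp [mul_add, h a₁ a₂ b₁ b₂, h' a₁ a₂ b₁ b₂]

theorem sub (h : K.HasDensity κ T) (h' : K.HasDensity κ' T') : K.HasDensity (κ - κ') (T - T') :=
  fun a₁ a₂ b₁ b₂ => by
    simp [mul_sub, h a₁ a₂ b₁ b₂, h' a₁ a₂ b₁ b₂]

theorem smul (h : K.HasDensity κ T) (c : ℝ) : K.HasDensity ((c : ℂ) • κ) (c • T) :=
  fun a₁ a₂ b₁ b₂ => by
    simp [mul_smul_comm, h a₁ a₂ b₁ b₂]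

/-- Both composites pair with `Λ(a') b'` to give `b'* κ(a'* x a) b`, because `(x* a')* a = a'* (x
a)`. -/
theorem commute (h : K.HasDensity κ T) (x : A) : Commute (K.π x) T := by
  refine ContinuousLinearMap.ext_on K.dense_range ?_
  rintro _ ⟨a, b, rfl⟩
  refine eq_of_ip_left_of_dense (B := B) K.dense_range ?_
  rintro _ ⟨a', b', rfl⟩
  change ip B (K.π x (T (K.Λ a b))) _ = ip B (T (K.π x (K.Λ a b))) _
  rw [K.π_star, K.π_Λ, K.π_Λ, ← h, ← h]
  simp [mul_assoc]

/-- Here `‖T Λ(f) b‖² ≤ ‖T‖ ‖b* κ(f* f) b‖`, and `f* f → 0` strictly and boundedly. Applied to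
differences in an approximate unit, it gives the Cauchy property behind `exists_vector`. -/
theorem tendsto_zero (h : K.HasDensity κ T) (hκ : IsStrict κ) (hT : IsPos B T) {ι : Type*}
    {l : Filter ι} {f : ι → φ.N} {r : ℝ}
    (hf : StrictTendsto (fun i => ((f i : A) : 𝓜(ℂ, A))) l 0) (hr : ∀ᶠ i in l, ‖(f i : A)‖ ≤ r)
    (b : B) : Tendsto (fun i => T (K.Λ (f i) b)) l (𝓝 0) := by
  have h1 := strictTendsto_coe_star_mul hf hr
  have h2 : StrictTendsto (fun i => κ (star (f i : A) * f i)) l (κ 0) := by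
    refine hκ.tendsto (r := r * r) ?_ ?_
    · convert h1 using 1
      rw [star_zero, zero_mul]
      exact map_zero (DoubleCentralizer.coeHom (𝕜 := ℂ) (A := A))
    · filter_upwards [hr] with i hi
      rw [CStarRing.norm_star_mul_self]
      exact mul_le_mul hi hi (norm_nonneg _) ((norm_nonneg _).trans hi)
  have h3 := ((h2.fst b).const_mul (star b)).norm.const_mul ‖T‖
  simp only [map_zero, DoubleCentralizer.zero_fst, zero_apply, mul_zero, norm_zero] at h3
  have h4 : Tendsto (fun i => ‖T (K.Λ (f i) b)‖ ^ 2) l (𝓝 0) :=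
    squeeze_zero (fun i => by positivity)
      (fun i => (hT.norm_apply_sq_le _).trans_eq (by rw [h])) h3
  have h5 := (Real.continuous_sqrt.tendsto 0).comp h4
  simp only [Function.comp_def, Real.sqrt_zero, Real.sqrt_sq (norm_nonneg _)] at h5
  exact tendsto_zero_iff_norm_tendsto_zero.2 h5

end HasDensity

variable (K)

theorem ip_π_star_mul (x y : A) (v w : E) :
    ip B (K.π (star x * y) v) w = ip B (K.π y v) (K.π x w) := by
  rw [map_mul]
  change ip B (K.π (star x) (K.π y v)) w = _
  rw [K.π_star, star_star]

/-- Since `x² ≤ x`, writing `x - x² = y* y` gives `⟨π(x) v, π(x) v⟩ ≤ ⟨π(x) v, v⟩`; one factor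
`‖π(x) v‖` then cancels. -/
theorem norm_π_apply_le_of_nonneg {x : A} (hx : 0 ≤ x) (hx1 : ‖x‖ ≤ 1) (v : E) :
    ‖K.π x v‖ ≤ ‖v‖ := by
  have h : 0 ≤ x - x * x := by
    have hs := CFC.sqrt_mul_sqrt_self x hx
    have hsa := (IsSelfAdjoint.of_nonneg (CFC.sqrt_nonneg x)).star_eq
    have h1 := CStarAlgebra.star_left_conjugate_le_norm_smul (a := CFC.sqrt x) (b := x)
      (hb := .of_nonneg hx)
    rw [hsa, hs] at h1
    generalize CFC.sqrt x = s at hs h1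
    have h2 : s * x * s = x * x := by
      simp only [← hs, mul_assoc]
    rw [h2] at h1
    have h3 : ‖x‖ • x ≤ (1 : ℝ) • x := smul_le_smul_of_nonneg_right hx1 hx
    rw [one_smul] at h3
    exact sub_nonneg.2 (h1.trans h3)
  obtain ⟨y, hy⟩ := CStarAlgebra.nonneg_iff_eq_star_mul_self.1 h
  have hxs := (IsSelfAdjoint.of_nonneg hx).star_eq
  have h1 : ip B (K.π (x - x * x) v) v = ip B (K.π y v) (K.π y v) := by
    rw [hy, ip_π_star_mul]
  have h2 : ip B (K.π (x - x * x) v) v = ip B (K.π x v) v - ip B (K.π x v) (K.π x v) := by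
    rw [map_sub, sub_apply, ip_sub_left]
    nth_rw 1 [← ip_π_star_mul, hxs]
  have h3 : ip B (K.π x v) (K.π x v) ≤ ip B (K.π x v) v := by
    rw [← sub_nonneg, ← h2, h1]
    exact ip_self_nonneg _
  have h4 := CStarAlgebra.norm_le_norm_of_nonneg_of_le (ip_self_nonneg _) h3
  rw [← norm_sq_eq_norm_ip] at h4
  have h5 := h4.trans (norm_ip_le _ _)
  rcases (norm_nonneg (K.π x v)).eq_or_lt with h0 | h0
  · rw [← h0]
    positivity
  · rw [sq] at h5
    exact le_of_mul_le_mul_left h5 h0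

/-- `π` is contractive. -/
theorem norm_π_apply_le (x : A) (v : E) : ‖K.π x v‖ ≤ ‖x‖ * ‖v‖ := by
  rcases eq_or_ne x 0 with rfl | hx
  · simp
  have hx0 : 0 < ‖x‖ ^ 2 := by positivity
  set w := (‖x‖ ^ 2)⁻¹ • (star x * x) with hw
  have hw0 : 0 ≤ w := smul_nonneg (by positivity) (star_mul_self_nonneg x)
  have hw1 : ‖w‖ ≤ 1 := by
    rw [hw, norm_smul, CStarRing.norm_star_mul_self, Real.norm_of_nonneg (by positivity), ← sq,
      inv_mul_cancel₀ hx0.ne']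
  have hxw : star x * x = ((‖x‖ ^ 2 : ℝ) : ℂ) • w := by
    rw [hw, Complex.coe_smul, smul_smul, mul_inv_cancel₀ hx0.ne', one_smul]
  have h1 : ‖K.π x v‖ ^ 2 ≤ (‖x‖ * ‖v‖) ^ 2 := by
    calc ‖K.π x v‖ ^ 2 = ‖ip B (K.π (star x * x) v) v‖ := by
          rw [norm_sq_eq_norm_ip (B := B), ip_π_star_mul]
      _ ≤ ‖K.π (star x * x) v‖ * ‖v‖ := norm_ip_le _ _
      _ = ‖x‖ ^ 2 * ‖K.π w v‖ * ‖v‖ := by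
          rw [hxw, map_smul, smul_apply, norm_smul, Complex.norm_real,
            Real.norm_of_nonneg hx0.le]
      _ ≤ ‖x‖ ^ 2 * ‖v‖ * ‖v‖ := by
          gcongr
          exact K.norm_π_apply_le_of_nonneg hw0 hw1 v
      _ = (‖x‖ * ‖v‖) ^ 2 := by ring
  exact le_of_sq_le_sq h1 (by positivity)

/-- `π` is strictly continuous on bounded sets, on the vectors on which it is nondegenerate. -/
theorem tendsto_π_apply {v : E} (hv : v ∈ closure {z | ∃ y w, K.π y w = z}) {ι : Type*}
    {l : Filter ι} {f : ι → A} {a : A} {r : ℝ}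
    (hf : StrictTendsto (fun i => (f i : 𝓜(ℂ, A))) l a) (hr : ∀ᶠ i in l, ‖f i‖ ≤ r) :
    Tendsto (fun i => K.π (f i) v) l (𝓝 (K.π a v)) := by
  rw [Metric.tendsto_nhds]
  intro ε hε
  set C := |r| + ‖a‖ + 1 with hC
  have hC0 : 0 < C := by positivity
  obtain ⟨_, ⟨y, w, rfl⟩, hyw⟩ := Metric.mem_closure_iff.1 hv (ε / (2 * C)) (by positivity)
  rw [dist_eq_norm] at hyw
  have h1 : Tendsto (fun i => ‖f i * y - a * y‖ * ‖w‖) l (𝓝 0) := by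
    have := ((tendsto_sub_nhds_zero_iff.2 ((strictTendsto_coe_iff.1 hf).1 y)).norm).mul_const ‖w‖
    simpa using this
  filter_upwards [h1.eventually (gt_mem_nhds (half_pos hε)), hr] with i hi hir
  -- The first term is small since `v` is close to `π(y) w` and `f i - a` is bounded; the second
  -- since `f i * y → a * y` in norm.
  have e : K.π (f i) v - K.π a v = K.π (f i - a) (v - K.π y w) + K.π (f i * y - a * y) w := by
    simp only [map_sub, map_mul, sub_apply]
    simp
  rw [dist_eq_norm, e]
  have h2 : ‖f i - a‖ ≤ C := (norm_sub_le _ _).trans (by linarith [le_abs_self r])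
  calc _ ≤ _ := norm_add_le _ _
    _ ≤ ‖f i - a‖ * ‖v - K.π y w‖ + ‖f i * y - a * y‖ * ‖w‖ :=
      add_le_add (K.norm_π_apply_le _ _) (K.norm_π_apply_le _ _)
    _ ≤ C * (ε / (2 * C)) + ‖f i * y - a * y‖ * ‖w‖ := by gcongr
    _ < ε / 2 + ε / 2 := by
      have : C * (ε / (2 * C)) = ε / 2 := by field_simp
      rw [this]
      gcongr
    _ = ε := add_halves ε

variable {K}

/-- Take `b = w`. This bounds the adjoint of `W` at a single vector, before that adjoint is known to
exist everywhere. -/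
theorem norm_le_of_star_mul_eq_ip {W : B →L[ℂ] E} {v : E}
    {w : B} (h : ∀ b, star b * w = ip B v (W b)) : ‖w‖ ≤ ‖v‖ * ‖W‖ := by
  rcases (norm_nonneg w).eq_or_lt with h0 | h0
  · rw [← h0]
    positivity
  refine le_of_mul_le_mul_right ?_ h0
  calc ‖w‖ * ‖w‖ = ‖ip B v (W w)‖ := by rw [← CStarRing.norm_star_mul_self, h]
    _ ≤ ‖v‖ * ‖W w‖ := norm_ip_le _ _
    _ ≤ ‖v‖ * (‖W‖ * ‖w‖) := by gcongr; exact W.le_opNorm w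
    _ = ‖v‖ * ‖W‖ * ‖w‖ := by ring

/-- If `T` is the density of `κ`, then there is an adjointable `W : B → E` that implements
`T Λ(1)`. -/
theorem HasDensity.exists_vector [CompleteSpace E] (hφ : φ.DenselyDefined)
    {κ : A →ₗ[ℂ] 𝓜(ℂ, B)} {T : E →L[ℂ] E} (h : K.HasDensity κ T) (hκ : IsStrict κ)
    (hT : IsPos B T) :
    ∃ (W : B →L[ℂ] E) (W' : E → B), (∀ v b, star b * W' v = ip B v (W b)) ∧
      (∀ (a : φ.N) b, K.π a (W b) = T (K.Λ a b)) ∧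
      ∀ b, W b ∈ closure {z | ∃ y w, K.π y w = z} := by
  obtain ⟨l, hl, hl2⟩ := hφ.exists_isApproximateUnit
  have := map_neBot_iff _ |>.1 hl.neBot
  have hl1 : StrictTendsto (fun e : φ.N => ((e : A) : 𝓜(ℂ, A))) l 1 :=
    (strictTendsto_of_isApproximateUnit hl 1).comp tendsto_map
  have hlim : ∀ b, ∃ z, Tendsto (fun e => T (K.Λ e b)) l (𝓝 z) := fun b => by
    refine CompleteSpace.complete (cauchy_map_of_sub ?_)
    have h1 := (hl1.comp (tendsto_snd (f := l))).sub (hl1.comp (tendsto_fst (g := l)))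
    simp only [← coe_sub, sub_self] at h1
    have h2 := h.tendsto_zero hκ hT (f := fun p : φ.N × φ.N => p.2 - p.1) (r := 2 + 2) h1 (by
      filter_upwards [tendsto_fst.eventually hl2, tendsto_snd.eventually hl2] with p hp hp'
      exact (norm_sub_le _ _).trans (add_le_add hp' hp)) b
    simpa using h2
  choose W hW using hlim
  -- This gives the adjoint of `W` on the span of the `Λ(a) b`: it sends `Λ(a) b` to `κ(a) b`. It
  -- yields the closed graph of `W`, and density extends the adjoint to `E`.
  have hΛW : ∀ (a : φ.N) b b', ip B (K.Λ a b) (W b') = star b' * (κ a).fst b := fun a b b' => by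
    have h1 : Tendsto (fun e : φ.N => star (e : A) * a) l (𝓝 a) := by
      have := ((hl.tendsto_mul_left (star (a : A))).comp tendsto_map).star
      simpa [Function.comp_def] using this
    refine tendsto_nhds_unique (tendsto_ip tendsto_const_nhds (hW b')) ?_
    simp only [← hT.sym _ _, ← h _ _ _ _]
    exact ((hκ.tendsto_of_tendsto h1).fst b).const_mul _
  let W₁ : B →ₗ[ℂ] E :=
    { toFun := W
      map_add' := fun x y => tendsto_nhds_unique (hW (x + y)) (by simpa using (hW x).add (hW y))
      map_smul' := fun c x => tendsto_nhds_unique (hW (c • x))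
        (by simpa using (hW x).const_smul c) }
  have hc : Continuous W₁ := by
    refine W₁.continuous_of_seq_closed_graph fun u x y hu hy => ?_
    refine eq_of_ip_left_of_dense (B := B) K.dense_range ?_
    rintro _ ⟨a, b, rfl⟩
    refine tendsto_nhds_unique (tendsto_ip hy tendsto_const_nhds) ?_
    have e : ∀ b', ip B (W₁ b') (K.Λ a b) = star ((κ a).fst b) * b' := fun b' => by
      rw [← star_ip]
      exact (congrArg star (hΛW a b b')).trans (by simp)
    simp only [e, Function.comp_def]
    exact hu.const_mul _
  let W₂ : B →L[ℂ] E := ⟨W₁, hc⟩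
  have hadj : ∀ v, ∃ w, ∀ b, star b * w = ip B v (W₂ b) := by
    have hspan : ∀ v ∈ Submodule.span ℂ {x : E | ∃ a b, K.Λ a b = x},
        ∃ w, ∀ b, star b * w = ip B v (W₂ b) := fun v hv => by
      induction hv using Submodule.span_induction with
      | mem v hv =>
        obtain ⟨a, b, rfl⟩ := hv
        exact ⟨_, fun b' => (hΛW a b b').symm⟩
      | zero => exact ⟨0, fun b => by simp⟩
      | add v v' _ _ hv hv' =>
        obtain ⟨w, hw⟩ := hv
        obtain ⟨w', hw'⟩ := hv'
        exact ⟨w + w', fun b => by rw [mul_add, hw, hw', ip_add_left]⟩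
      | smul c v _ hv =>
        obtain ⟨w, hw⟩ := hv
        exact ⟨c • w, fun b => by rw [mul_smul_comm, hw, ip_smul_left]⟩
    intro v
    obtain ⟨s, hs, hsv⟩ := mem_closure_iff_seq_limit.1 (K.dense_range v)
    choose w hw using fun n => hspan (s n) (hs n)
    have hcau : Cauchy (atTop.map w) := by
      refine cauchy_map_of_sub ?_
      have h1 : Tendsto (fun p : ℕ × ℕ => ‖s p.2 - s p.1‖ * ‖W₂‖) (atTop ×ˢ atTop) (𝓝 0) := by
        have h2 := ((hsv.comp (tendsto_snd (f := atTop))).sub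
          (hsv.comp (tendsto_fst (g := atTop)))).norm.mul_const ‖W₂‖
        simpa using h2
      refine squeeze_zero_norm (fun p => ?_) h1
      exact norm_le_of_star_mul_eq_ip fun b => by rw [mul_sub, hw, hw, ip_sub_left]
    obtain ⟨w₀, hw₀⟩ := CompleteSpace.complete hcau
    refine ⟨w₀, fun b => tendsto_nhds_unique (Tendsto.const_mul _ hw₀) ?_⟩
    simp only [hw]
    exact tendsto_ip hsv tendsto_const_nhds
  choose W' hW' using hadj
  have hπ : ∀ (a : φ.N) b, K.π a (W₂ b) = T (K.Λ a b) := fun a b => by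
    refine eq_of_ip_left_of_dense (B := B) K.dense_range ?_
    rintro _ ⟨a', b', rfl⟩
    rw [K.π_star, K.π_Λ, ← star_ip]
    refine (congrArg star (hΛW _ b' b)).trans ?_
    rw [hT.sym, ← star_ip (T (K.Λ a' b')) (K.Λ a b), ← h]
  refine ⟨W₂, W', hW', hπ, fun b => ?_⟩
  -- `W b` is the limit of `T Λ(e) b = π(e) W b`.
  refine mem_closure_of_tendsto (hW b) (Eventually.of_forall fun e => ⟨e, W₂ b, hπ e b⟩)

end KSGNS

theorem eq_of_forall_star_mul_eq {A : Type*} [NonUnitalCStarAlgebra A] {x y : A}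
    (h : ∀ c, star c * x = star c * y) : x = y :=
  eq_of_forall_mul_eq fun c => by simpa using h (star c)

/-! ### Strict maps built from densities, and directedness of `𝓖_φ`. -/

namespace KSGNS

variable {A B : Type*} [NonUnitalCStarAlgebra A] [PartialOrder A] [StarOrderedRing A]
  [NonUnitalCStarAlgebra B] [PartialOrder B] [StarOrderedRing B]
  {φ : CStarWeight A B} {E : Type*} [NormedAddCommGroup E] [NormedSpace ℂ E]
  [SMul Bᵐᵒᵖ E] [CStarModule Bᵐᵒᵖ E] {K : KSGNS φ E}

/-- If `T₁`, `T₂` are densities of strict maps and `R` commutes with `π(A)`, then `T₁ R T₂` is the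
density of a strict map. -/
theorem HasDensity.exists_mul_mul [CompleteSpace E] (hφ : φ.DenselyDefined)
    {κ₁ κ₂ : A →ₗ[ℂ] 𝓜(ℂ, B)} {T₁ T₂ R R' : E →L[ℂ] E} (h₁ : K.HasDensity κ₁ T₁)
    (h₂ : K.HasDensity κ₂ T₂) (hκ₁ : IsStrict κ₁) (hκ₂ : IsStrict κ₂) (hT₁ : IsPos B T₁)
    (hT₂ : IsPos B T₂) (hR : ∀ v w, ip B (R v) w = ip B v (R' w))
    (hRπ : ∀ x, Commute (K.π x) R) :
    ∃ κ : A →ₗ[ℂ] 𝓜(ℂ, B), IsStrict κ ∧ K.HasDensity κ (T₁ * R * T₂) := by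
  obtain ⟨W₁, W₁', hW₁', hW₁, hW₁c⟩ := h₁.exists_vector hφ hκ₁ hT₁
  obtain ⟨W₂, W₂', hW₂', hW₂, hW₂c⟩ := h₂.exists_vector hφ hκ₂ hT₂
  have hRπ' : ∀ x v, K.π x (R v) = R (K.π x v) := fun x v => DFunLike.congr_fun (hRπ x) v
  have hswap : ∀ x v w, ip B (R (K.π x v)) w = ip B v (R' (K.π (star x) w)) := fun x v w => by
    rw [← hRπ', K.π_star, hR]
  -- The map sought is `κ(x) = W₁* R π(x) W₂`; commutation of `R` with `π(x)` supplies the right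
  -- multiplier.
  have hex : ∀ x, ∃ m : 𝓜(ℂ, B), ∀ b c,
      star c * m.fst b = ip B (R (K.π x (W₂ b))) (W₁ c) := fun x => by
    obtain ⟨m, hm, -⟩ := exists_multiplier (L := fun b => W₁' (R (K.π x (W₂ b))))
      (R := fun c => star (W₂' (R' (K.π (star x) (W₁ (star c)))))) fun c b => by
        rw [← star_star b, ← star_mul, star_star, hW₂', star_ip, ← hswap, ← hW₁', star_star]
    exact ⟨m, fun b c => by rw [hm, hW₁']⟩
  choose κ₀ hκ₀ using hex
  let κ : A →ₗ[ℂ] 𝓜(ℂ, B) :=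
    { toFun := κ₀
      map_add' := fun x y => ext_fst fun b => eq_of_forall_star_mul_eq fun c => by
        simp [mul_add, hκ₀]
      map_smul' := fun z x => ext_fst fun b => eq_of_forall_star_mul_eq fun c => by
        simp [mul_smul_comm, hκ₀] }
  have hκ : ∀ x b c, star c * (κ x).fst b = ip B (R (K.π x (W₂ b))) (W₁ c) := hκ₀
  refine ⟨κ, .of_tendsto fun l a r hr hl => ?_, fun a₁ a₂ b₁ b₂ => ?_⟩
  · refine strictTendsto_iff.2 ⟨fun b => ?_, fun c => ?_⟩
    · rw [← tendsto_sub_nhds_zero_iff]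
      have h0 : Tendsto (fun x => ‖R (K.π x (W₂ b)) - R (K.π a (W₂ b))‖ * ‖W₁‖) l (𝓝 0) := by
        have := (((R.continuous.tendsto _).comp
          (K.tendsto_π_apply (hW₂c b) hl hr)).sub_const (R (K.π a (W₂ b)))).norm.mul_const ‖W₁‖
        simpa using this
      refine squeeze_zero_norm (fun x => norm_le_of_star_mul_eq_ip fun c => ?_) h0
      rw [mul_sub, hκ, hκ, ip_sub_left]
    -- For right multiplication the adjoint is taken, so that `π(x*)` acts on the range of `W₁`,
    -- where `π` is strictly continuous on bounded sets as well.
    · rw [← tendsto_sub_nhds_zero_iff]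
      have hl' : StrictTendsto (fun x : A => ((star x : A) : 𝓜(ℂ, A))) l
          ((star a : A) : 𝓜(ℂ, A)) := by
        simp only [coe_star]
        exact hl.star
      have hr' : ∀ᶠ x : A in l, ‖star x‖ ≤ r := by simpa using hr
      have h0 : Tendsto (fun x => ‖R' (K.π (star x) (W₁ (star c)))
          - R' (K.π (star a) (W₁ (star c)))‖ * ‖W₂‖) l (𝓝 0) := by
        have := (((R'.continuous.tendsto _).comp
          (K.tendsto_π_apply (hW₁c (star c)) hl' hr')).sub_const
            (R' (K.π (star a) (W₁ (star c))))).norm.mul_const ‖W₂‖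
        simpa using this
      refine squeeze_zero_norm (fun x => ?_) h0
      rw [← norm_star]
      refine norm_le_of_star_mul_eq_ip fun b => ?_
      rw [← star_mul, sub_mul, DoubleCentralizer.central, DoubleCentralizer.central, ← star_star c,
        hκ, hκ, hswap, hswap, star_sub, star_ip, star_ip, ip_sub_left, star_star]
  · rw [hκ, hRπ' _ _ |>.symm, ip_π_star_mul, hRπ', hW₁, hW₂, ← hT₁.sym]
    rfl

/-- A strict map with a positive density is completely positive. -/
theorem HasDensity.isCP (hφ : φ.DenselyDefined) {κ : A →ₗ[ℂ] 𝓜(ℂ, B)} {T : E →L[ℂ] E}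
    (h : K.HasDensity κ T) (hκ : IsStrict κ) (hT : IsPos B T) : IsCP κ := by
  obtain ⟨l, hl, -⟩ := hφ.exists_isApproximateUnit
  have := map_neBot_iff _ |>.1 hl.neBot
  intro n a b
  have h1 : ∀ i, Tendsto (fun e : φ.N => a i * e) l (𝓝 (a i)) := fun i =>
    (hl.tendsto_mul_left (a i)).comp tendsto_map
  -- With `aᵢ e ∈ N_φ` in place of `aᵢ` the double sum is `⟨T ξ, ξ⟩` for `ξ = ∑ Λ(aᵢ e) bᵢ`.
  have h2 : Tendsto (fun e : φ.N => ∑ i, ∑ j,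
      star (b j) * (κ (star (a j * e) * (a i * e))).fst (b i)) l
      (𝓝 (∑ i, ∑ j, star (b j) * (κ (star (a j) * a i)).fst (b i))) :=
    tendsto_finsetSum _ fun i _ => tendsto_finsetSum _ fun j _ =>
      ((hκ.tendsto_of_tendsto ((h1 j).star.mul (h1 i))).fst (b i)).const_mul _
  refine ge_of_tendsto' h2 fun e => ?_
  have h3 : ∀ i j, star (b j) * (κ (star (a j * e) * (a i * e))).fst (b i)
      = ip B (T (K.Λ ⟨a i * e, φ.mul_mem_N _ e⟩ (b i))) (K.Λ ⟨a j * e, φ.mul_mem_N _ e⟩ (b j)) :=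
    fun i j => h ⟨a i * e, φ.mul_mem_N _ e⟩ ⟨a j * e, φ.mul_mem_N _ e⟩ (b i) (b j)
  simp only [h3, ← ip_sum_right, ← ip_sum_left, ← map_sum]
  exact hT.nonneg _

variable (K)

theorem mem_F_iff {ρ : A →ₗ[ℂ] 𝓜(ℂ, B)} : ρ ∈ K.F ↔ IsCP ρ ∧ IsStrict ρ ∧
    ∃ T, IsPos B T ∧ K.HasDensity ρ T ∧ IsPos B (1 - T) := by
  constructor
  · rintro ⟨⟨h1, h2, -⟩, T, ⟨hT, hd⟩, hT1⟩
    exact ⟨h1, h2, T, hT.isPos, hd, .of_nonneg fun x => by simpa using hT1 x⟩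
  · rintro ⟨h1, h2, T, hT, hd, hT1⟩
    exact ⟨⟨h1, h2, T, hT.isPositiveOp, hd⟩, T, ⟨hT.isPositiveOp, hd⟩, fun x => by
      simpa using hT1.nonneg x⟩

instance : Nonempty K.Idx := by
  refine ⟨⟨0, 0, le_rfl, one_pos, 0, K.mem_F_iff.2 ⟨fun n a b => by simp, ?_, 0, .zero, ?_, ?_⟩,
    by simp⟩⟩
  · exact .of_tendsto fun _ _ _ _ _ => .const
  · exact fun _ _ _ _ => by simp
  · simpa using IsPos.one

/-- `𝓖_φ` is upward directed. -/
theorem isDirectedOrder [CompleteSpace E] (hφ : φ.DenselyDefined) : IsDirectedOrder K.Idx := by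
  refine ⟨fun ⟨σ₁, l₁, hl₁, hl₁', τ₁, hτ₁, e₁⟩ ⟨σ₂, l₂, hl₂, hl₂', τ₂, hτ₂, e₂⟩ => ?_⟩
  obtain ⟨-, hs₁, T₁, hT₁, hd₁, hT₁'⟩ := K.mem_F_iff.1 hτ₁
  obtain ⟨-, hs₂, T₂, hT₂, hd₂, hT₂'⟩ := K.mem_F_iff.1 hτ₂
  -- A common scale for both maps; the entry `1 / 2` only ensures `0 < l`, as `exists_upper_bound`
  -- requires.
  set l : ℝ := max (max l₁ l₂) (1 / 2)
  have hl0 : 0 < l := lt_of_lt_of_le (by norm_num) (le_max_right _ _)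
  have hl1 : l < 1 := max_lt (max_lt hl₁' hl₂') (by norm_num)
  have hll₁ : l₁ ≤ l := (le_max_left _ _).trans (le_max_left _ _)
  have hll₂ : l₂ ≤ l := (le_max_right _ _).trans (le_max_left _ _)
  have hX := hT₁.smul hl0.le
  have hY := hT₂.smul hl0.le
  have hdX := hd₁.smul l
  have hdY := hd₂.smul l
  have hsX := hs₁.smul (l : ℂ)
  have hsY := hs₂.smul (l : ℂ)
  obtain ⟨G₁, G₂, Q, T, l', hG₁, hG₂, hQ, hcomm, hT, hTX, hTY, hl'0, hl'1, hTl'⟩ :=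
    IsPos.exists_upper_bound hl0 hl1 hX (by rw [← smul_sub]; exact hT₁'.smul hl0.le) hY
      (by rw [← smul_sub]; exact hT₂'.smul hl0.le)
  have hπ := fun x => hcomm (K.π x) (hdX.commute x) (hdY.commute x)
  have hmul : ∀ {S R S' : E →L[ℂ] E}, IsSym B S → IsSym B R → IsSym B S' →
      ∀ v w, ip B ((S * R * S') v) w = ip B v ((S' * R * S) w) := fun hS hR hS' v w => by
    simp [hS _ _, hR _ _, hS' _ _]
  obtain ⟨κ₁₁, hs₁₁, hd₁₁⟩ := hdX.exists_mul_mul hφ hdX hsX hsX hX hX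
    (hG₁.sub (hQ.mul_mul hG₁)) fun x =>
      (hπ x).1.sub_right (((hπ x).1.mul_right (hπ x).2.2).mul_right (hπ x).1)
  obtain ⟨κ₂₂, hs₂₂, hd₂₂⟩ := hdY.exists_mul_mul hφ hdY hsY hsY hY hY
    (hG₂.sub (hQ.mul_mul hG₂)) fun x =>
      (hπ x).2.1.sub_right (((hπ x).2.1.mul_right (hπ x).2.2).mul_right (hπ x).2.1)
  obtain ⟨κ₁₂, hs₁₂, hd₁₂⟩ := hdX.exists_mul_mul hφ hdY hsX hsY hX hY
    (hmul hG₁ hQ hG₂) fun x => ((hπ x).1.mul_right (hπ x).2.2).mul_right (hπ x).2.1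
  obtain ⟨κ₂₁, hs₂₁, hd₂₁⟩ := hdY.exists_mul_mul hφ hdX hsY hsX hY hX
    (hmul hG₂ hQ hG₁) fun x => ((hπ x).2.1.mul_right (hπ x).2.2).mul_right (hπ x).1
  have hd := ((((hdX.add hdY).add hd₁₁).add hd₂₂).sub hd₁₂).sub hd₂₁
  have hs := ((((hsX.add hsY).add hs₁₁).add hs₂₂).sub hs₁₂).sub hs₂₁
  rw [← hT] at hd
  set κ := (l : ℂ) • τ₁ + (l : ℂ) • τ₂ + κ₁₁ + κ₂₂ - κ₁₂ - κ₂₁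
  have hTpos : IsPos B T := by
    have := hTX.add hX
    rwa [sub_add_cancel] at this
  -- The strict map `κ` has density `T ≤ l' < 1`, so `κ` is `l'` times an element of `𝓕_φ`.
  have hF : (((l'⁻¹ : ℝ) : ℂ) • κ) ∈ K.F := by
    have hs' := hs.smul ((l'⁻¹ : ℝ) : ℂ)
    have hT' := hTpos.smul (inv_nonneg.2 hl'0.le)
    refine K.mem_F_iff.2 ⟨(hd.smul l'⁻¹).isCP hφ hs' hT', hs', _, hT', hd.smul l'⁻¹, ?_⟩
    have := hTl'.smul (inv_nonneg.2 hl'0.le)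
    rwa [smul_sub, smul_smul, inv_mul_cancel₀ hl'0.ne', one_smul] at this
  have hle : ∀ {τ : A →ₗ[ℂ] 𝓜(ℂ, B)} {S : E →L[ℂ] E} {k : ℝ}, k ≤ l → IsStrict τ → IsPos B S →
      K.HasDensity τ S → IsPos B (T - l • S) → IsCP (κ - (k : ℂ) • τ) := by
    intro τ S k hk hτ hS hdτ hTS
    refine (hd.sub (hdτ.smul k)).isCP hφ (hs.sub (hτ.smul _)) ?_
    -- The density of `κ - k τ` is `T - k S = (T - l S) + (l - k) S`.
    have := hTS.add (hS.smul (sub_nonneg.2 hk))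
    convert this using 1
    rw [sub_smul]
    abel
  refine ⟨⟨κ, l', hl'0.le, hl'1, _, hF, ?_⟩, ?_, ?_⟩
  · rw [smul_smul, ← Complex.ofReal_mul, mul_inv_cancel₀ hl'0.ne', Complex.ofReal_one, one_smul]
  · change IsCP (κ - σ₁)
    rw [e₁]
    exact hle hll₁ hs₁ hT₁ hd₁ hTX
  · change IsCP (κ - σ₂)
    rw [e₂]
    exact hle hll₂ hs₂ hT₂ hd₂ hTY

end KSGNS

section Operators

variable {B : Type*} [NonUnitalCStarAlgebra B] [PartialOrder B] [StarOrderedRing B]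

/-- `0 ≤ S ≤ T` implies `‖S‖ ≤ ‖T‖`. -/
theorem IsPos.norm_le_norm {E : Type*} [NormedAddCommGroup E] [NormedSpace ℂ E] [SMul Bᵐᵒᵖ E]
    [CStarModule Bᵐᵒᵖ E] [CompleteSpace E] {S T : E →L[ℂ] E} (hS : IsPos B S)
    (hST : IsPos B (T - S)) : ‖S‖ ≤ ‖T‖ := by
  have hT : IsPos B T := by
    have := hST.add hS
    rwa [sub_add_cancel] at this
  refine le_of_forall_gt_imp_ge_of_dense fun c hc => ?_
  have hc0 : 0 < c := (norm_nonneg T).trans_lt hc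
  refine hS.norm_le_of_le hc0 ?_
  have h1 : IsPos B (1 - c⁻¹ • T) := by
    refine (hT.smul (inv_nonneg.2 hc0.le)).one_sub_of_norm_le_one ?_
    rw [norm_smul, Real.norm_of_nonneg (inv_nonneg.2 hc0.le), inv_mul_le_iff₀ hc0, mul_one]
    exact hc.le
  have h2 := (h1.smul hc0.le).add hST
  convert h2 using 1
  rw [smul_sub, smul_smul, mul_inv_cancel₀ hc0.ne', one_smul]
  abel

/-! ### Positive multipliers -/

/-- Left multiplication by `m` is an operator on `B` as a Hilbert module over itself, so the results
on positive operators apply to multipliers. -/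
theorem isPos_fst {m : 𝓜(ℂ, B)} (h : ∀ b, 0 ≤ star b * m.fst b) : IsPos B m.fst :=
  .of_nonneg h

theorem star_eq_of_isPos_fst {m : 𝓜(ℂ, B)} (h : IsPos B m.fst) : star m = m :=
  ext_fst fun b => eq_of_forall_star_mul_eq fun c => by
    rw [← star_fst_mul]
    exact (h.sym b c).symm

theorem snd_eq_of_isPos_fst {m : 𝓜(ℂ, B)} (h : IsPos B m.fst) (c : B) :
    m.snd c = star (m.fst (star c)) := by
  conv_lhs => rw [← star_eq_of_isPos_fst h]
  exact DoubleCentralizer.star_snd m c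

theorem norm_fst_sq_le_of_isPos_fst {m : 𝓜(ℂ, B)} (h : IsPos B m.fst) (b : B) :
    ‖m.fst b‖ ^ 2 ≤ ‖m‖ * ‖star b * m.fst b‖ := by
  have := h.norm_apply_sq_le b
  rwa [DoubleCentralizer.norm_fst] at this

/-- A bounded net of positive multipliers `m` with `b* m b → 0` for all `b` converges strictly. -/
theorem strictTendsto_zero_of_isPos_fst {ι : Type*} {l : Filter ι} {f : ι → 𝓜(ℂ, B)} {C : ℝ}
    (h : ∀ i, IsPos B (f i).fst) (hC : ∀ i, ‖f i‖ ≤ C)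
    (h0 : ∀ b, Tendsto (fun i => star b * (f i).fst b) l (𝓝 0)) : StrictTendsto f l 0 := by
  have h1 : ∀ b, Tendsto (fun i => (f i).fst b) l (𝓝 0) := fun b => by
    have h2 := (h0 b).norm.const_mul C
    rw [norm_zero, mul_zero] at h2
    have h3 : Tendsto (fun i => ‖(f i).fst b‖ ^ 2) l (𝓝 0) :=
      squeeze_zero (fun i => by positivity) (fun i => (norm_fst_sq_le_of_isPos_fst (h i) b).trans
        (by gcongr; exact hC i)) h2
    have h4 := (Real.continuous_sqrt.tendsto 0).comp h3
    simp only [Function.comp_def, Real.sqrt_zero, Real.sqrt_sq (norm_nonneg _)] at h4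
    exact tendsto_zero_iff_norm_tendsto_zero.2 h4
  refine strictTendsto_iff.2 ⟨fun b => by simpa using h1 b, fun b => ?_⟩
  simp only [fun i => snd_eq_of_isPos_fst (h i) b]
  simpa using (h1 (star b)).star

/-- A family of positive multipliers that is pointwise bounded in the form sense is bounded. -/
theorem exists_norm_le_of_isPos_fst {ι : Type*} {f : ι → 𝓜(ℂ, B)} (h : ∀ i, IsPos B (f i).fst)
    (hb : ∀ b, ∃ C, ∀ i, ‖star b * (f i).fst b‖ ≤ C) : ∃ C, ∀ i, ‖f i‖ ≤ C := by
  -- The scaling is chosen so that `‖m b‖² / ‖m‖ ≤ ‖b* m b‖` gives pointwise bounds, while the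
  -- scaled operator still has norm `√‖m‖`. For `m = 0` the convention `0⁻¹ = 0` is harmless.
  obtain ⟨C, hC⟩ := banach_steinhaus (g := fun i => (√‖f i‖)⁻¹ • (f i).fst) fun b => by
    obtain ⟨C, hC⟩ := hb b
    refine ⟨√C, fun i => Real.le_sqrt_of_sq_le ?_⟩
    rw [smul_apply, norm_smul, mul_pow, norm_inv, inv_pow, Real.norm_of_nonneg (Real.sqrt_nonneg _),
      Real.sq_sqrt (norm_nonneg _)]
    rcases (norm_nonneg (f i)).eq_or_lt with h0 | h0
    · rw [← h0, inv_zero, zero_mul]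
      exact (norm_nonneg _).trans (hC i)
    · rw [inv_mul_le_iff₀ h0]
      exact (norm_fst_sq_le_of_isPos_fst (h i) b).trans (by gcongr; exact hC i)
  refine ⟨C ^ 2, fun i => ?_⟩
  have h1 := hC i
  rw [norm_smul, norm_inv, Real.norm_of_nonneg (Real.sqrt_nonneg _), DoubleCentralizer.norm_fst,
    ← div_eq_inv_mul, Real.div_sqrt] at h1
  exact (Real.sqrt_le_left ((Real.sqrt_nonneg _).trans h1)).1 h1

/-- A net of positive multipliers that is increasing, with `b* m b` convergent for all `b`,
converges strictly. -/
theorem exists_strictTendsto_of_monotone {ι : Type*} [Preorder ι] [IsDirectedOrder ι] [Nonempty ι]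
    {f : ι → 𝓜(ℂ, B)} (h : ∀ i, IsPos B (f i).fst)
    (hmono : ∀ i j, i ≤ j → IsPos B (f j - f i).fst)
    (hlim : ∀ b, ∃ y, Tendsto (fun i => star b * (f i).fst b) atTop (𝓝 y)) :
    ∃ m, StrictTendsto f atTop m := by
  choose L hL using hlim
  have hle : ∀ b i j, i ≤ j → star b * (f i).fst b ≤ star b * (f j).fst b := fun b i j hij => by
    have := (hmono i j hij).nonneg b
    change 0 ≤ star b * ((f j).fst b - (f i).fst b) at this
    rwa [mul_sub, sub_nonneg] at this
  have hleL : ∀ b i, star b * (f i).fst b ≤ L b := fun b i =>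
    ge_of_tendsto (hL b) ((eventually_ge_atTop i).mono fun j => hle b i j)
  obtain ⟨C, hC⟩ := exists_norm_le_of_isPos_fst h fun b => ⟨‖L b‖, fun i =>
    CStarAlgebra.norm_le_norm_of_nonneg_of_le ((h i).nonneg b) (hleL b i)⟩
  have hfst : ∀ b, ∃ y, Tendsto (fun i => (f i).fst b) atTop (𝓝 y) := fun b => by
    refine CompleteSpace.complete (Metric.cauchy_iff.2 ⟨inferInstance, fun ε hε => ?_⟩)
    have h1 : Tendsto (fun i => C * ‖L b - star b * (f i).fst b‖) atTop (𝓝 0) := by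
      have := ((hL b).const_sub (L b)).norm.const_mul C
      simpa using this
    obtain ⟨i, hi⟩ := (h1.eventually (gt_mem_nhds (by positivity : 0 < (ε / 2) ^ 2))).exists
    -- Since `0 ≤ f j - f i ≤ f j`, the difference has norm at most `C`, and `‖(f j - f i) b‖² ≤ C
    -- ‖L b - b* (f i) b‖`.
    have h2 : ∀ j, i ≤ j → ‖(f j).fst b - (f i).fst b‖ < ε / 2 := fun j hij => by
      have hp := hmono i j hij
      have h3 : ‖f j - f i‖ ≤ C := by
        refine le_trans ?_ (hC j)
        rw [← DoubleCentralizer.norm_fst, ← DoubleCentralizer.norm_fst (f j)]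
        refine hp.norm_le_norm ?_
        rw [DoubleCentralizer.sub_fst, sub_sub_cancel]
        exact h i
      have h4 := norm_fst_sq_le_of_isPos_fst hp b
      have h5 : ‖star b * (f j - f i).fst b‖ ≤ ‖L b - star b * (f i).fst b‖ := by
        refine CStarAlgebra.norm_le_norm_of_nonneg_of_le (hp.nonneg b) ?_
        change star b * ((f j).fst b - (f i).fst b) ≤ _
        rw [mul_sub]
        exact sub_le_sub_right (hleL b j) _
      have h6 : ‖(f j - f i).fst b‖ ^ 2 < (ε / 2) ^ 2 :=
        (h4.trans (mul_le_mul h3 h5 (norm_nonneg _) ((norm_nonneg _).trans h3))).trans_lt hi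
      exact lt_of_pow_lt_pow_left₀ 2 (by positivity) h6
    refine ⟨_, image_mem_map (Ici_mem_atTop i), ?_⟩
    rintro _ ⟨j, hj, rfl⟩ _ ⟨k, hk, rfl⟩
    calc dist ((f j).fst b) ((f k).fst b)
        ≤ dist ((f j).fst b) ((f i).fst b) + dist ((f k).fst b) ((f i).fst b) :=
          dist_triangle_right _ _ _
      _ < ε / 2 + ε / 2 := by
          rw [dist_eq_norm, dist_eq_norm]
          exact add_lt_add (h2 j hj) (h2 k hk)
      _ = ε := add_halves ε
  refine exists_strictTendsto hfst fun b => ?_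
  obtain ⟨y, hy⟩ := hfst (star b)
  refine ⟨star y, ?_⟩
  simp only [fun i => snd_eq_of_isPos_fst (h i) b]
  exact hy.star

end Operators

/-! ### Order properties of strict extensions -/

section StrictExtension

variable {A B : Type*} [NonUnitalCStarAlgebra A] [PartialOrder A] [StarOrderedRing A]
  [NonUnitalCStarAlgebra B] {ρ σ : A →ₗ[ℂ] 𝓜(ℂ, B)}

/-- The value at `(x u)* (x u)` of the extension of `ρ` is approximated by those of `ρ` at
`(x e u)* (x e u)`, for an approximate unit `(e)`. -/
theorem IsStrict.tendsto_strictExtension (hρ : IsStrict ρ) {l : Filter A}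
    (hl : l.IsApproximateUnit) {r : ℝ} (hr : ∀ᶠ e in l, ‖e‖ ≤ r) (x u : 𝓜(ℂ, A)) :
    StrictTendsto (fun e => ρ (star (u.snd (x.fst e)) * u.snd (x.fst e))) l
      (strictExtension ρ (star (x * u) * (x * u))) := by
  have h0 : ∀ y : A, ((u.snd y : A) : 𝓜(ℂ, A)) = y * u := fun y => ext_fst fun c => by
    simpa using u.central y c
  have hx := strictTendsto_of_isApproximateUnit hl x
  have hxr : ∀ᶠ e in l, ‖x.fst e‖ ≤ ‖x‖ * r := hr.mono fun e he =>
    (norm_fst_apply_le _ _).trans (by gcongr)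
  have h1 : StrictTendsto (fun e => ((u.snd (x.fst e) : A) : 𝓜(ℂ, A))) l (x * u) := by
    simp only [h0]
    exact hx.mul .const (r := max (‖x‖ * r) ‖u‖)
      (hxr.mono fun e he => ((norm_coe_le _).trans he).trans (le_max_left _ _))
      (.of_forall fun _ => le_max_right _ _)
  have h2 : ∀ᶠ e in l, ‖u.snd (x.fst e)‖ ≤ ‖u‖ * (‖x‖ * r) := hxr.mono fun e he =>
    (norm_snd_apply_le _ _).trans (by gcongr)
  have h3 := strictTendsto_coe_star_mul h1 h2
  have h4 : ∀ᶠ e in l, ‖((star (u.snd (x.fst e)) * u.snd (x.fst e) : A) : 𝓜(ℂ, A))‖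
      ≤ (‖u‖ * (‖x‖ * r)) * (‖u‖ * (‖x‖ * r)) := h2.mono fun e he => by
    refine (norm_coe_le _).trans ?_
    rw [CStarRing.norm_star_mul_self]
    exact mul_le_mul he he (norm_nonneg _) ((norm_nonneg _).trans he)
  have h5 := hρ.isStrictExtension.tendsto h3 h4
  simpa only [hρ.isStrictExtension.1] using h5

theorem IsStrict.tendsto_strictExtension' (hρ : IsStrict ρ) {l : Filter A}
    (hl : l.IsApproximateUnit) {r : ℝ} (hr : ∀ᶠ e in l, ‖e‖ ≤ r) (x : 𝓜(ℂ, A)) :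
    StrictTendsto (fun e => ρ (star (x.fst e) * x.fst e)) l
      (strictExtension ρ (star x * x)) := by
  simpa using! hρ.tendsto_strictExtension hl hr x 1

/-- The extension is a choice, so homogeneity in `ρ` is not definitional; both sides are the strict
limit of `z ρ(x e)`. -/
theorem strictExtension_smul (hρ : IsStrict ρ) (z : ℂ) (x : 𝓜(ℂ, A)) :
    strictExtension (z • ρ) x = z • strictExtension ρ x := by
  obtain ⟨l, hl, hl2, -⟩ := exists_isApproximateUnit_of_dense (A := A) dense_univ
  have := hl.neBot
  have hx := strictTendsto_of_isApproximateUnit hl x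
  have hxr : ∀ᶠ e in l, ‖((x.fst e : A) : 𝓜(ℂ, A))‖ ≤ ‖x‖ * 2 := hl2.mono fun e he =>
    (norm_coe_le _).trans ((norm_fst_apply_le _ _).trans (by gcongr))
  have h1 := (hρ.smul z).isStrictExtension.tendsto hx hxr
  have h2 := (hρ.isStrictExtension.tendsto hx hxr).smul z
  simp only [(hρ.smul z).isStrictExtension.1, hρ.isStrictExtension.1] at h1 h2
  exact h1.unique h2

variable [PartialOrder B] [StarOrderedRing B]

omit [PartialOrder A] [StarOrderedRing A] [StarOrderedRing B] in
theorem IsCP.nonneg (h : IsCP ρ) (y : A) (b : B) : 0 ≤ star b * (ρ (star y * y)).fst b := by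
  simpa using h 1 (fun _ => y) fun _ => b

/-- With `a = x* x`, the value at `a` is a limit of values of `ρ` at `(x e)* (x e)` with `x e ∈ A`.
-/
theorem IsCP.strictExtension_nonneg (h : IsCP ρ) (hρ : IsStrict ρ) {a : 𝓜(ℂ, A)} (ha : 0 ≤ a)
    (b : B) : 0 ≤ star b * (strictExtension ρ a).fst b := by
  obtain ⟨l, hl, hl2, -⟩ := exists_isApproximateUnit_of_dense (A := A) dense_univ
  have := hl.neBot
  obtain ⟨x, rfl⟩ := CStarAlgebra.nonneg_iff_eq_star_mul_self.1 ha
  exact ge_of_tendsto' (((hρ.tendsto_strictExtension' hl hl2 x).fst b).const_mul (star b))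
    fun e => h.nonneg _ b

theorem IsCP.strictExtension_le (h : IsCP (σ - ρ)) (hρ : IsStrict ρ) (hσ : IsStrict σ)
    {a : 𝓜(ℂ, A)} (ha : 0 ≤ a) (b : B) :
    star b * (strictExtension ρ a).fst b ≤ star b * (strictExtension σ a).fst b := by
  obtain ⟨l, hl, hl2, -⟩ := exists_isApproximateUnit_of_dense (A := A) dense_univ
  have := hl.neBot
  obtain ⟨x, rfl⟩ := CStarAlgebra.nonneg_iff_eq_star_mul_self.1 ha
  refine le_of_tendsto_of_tendsto'
    (((hρ.tendsto_strictExtension' hl hl2 x).fst b).const_mul (star b))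
    (((hσ.tendsto_strictExtension' hl hl2 x).fst b).const_mul (star b)) fun e => ?_
  have := h.nonneg (x.fst e) b
  change 0 ≤ star b * ((σ _).fst b - (ρ _).fst b) at this
  rwa [mul_sub, sub_nonneg] at this

end StrictExtension

/-! ### Convergence along `𝓖_φ`. -/

namespace KSGNS

variable {A B : Type*} [NonUnitalCStarAlgebra A] [PartialOrder A] [StarOrderedRing A]
  [NonUnitalCStarAlgebra B] [PartialOrder B] [StarOrderedRing B]
  {φ : CStarWeight A B} {E : Type*} [NormedAddCommGroup E] [NormedSpace ℂ E]
  [SMul Bᵐᵒᵖ E] [CStarModule Bᵐᵒᵖ E] {K : KSGNS φ E}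

theorem G_subset_F (hφ : φ.DenselyDefined) : K.G ⊆ K.F := by
  rintro _ ⟨l, hl, hl1, τ, hτ, rfl⟩
  obtain ⟨-, hs, T, hT, hd, hT1⟩ := K.mem_F_iff.1 hτ
  refine K.mem_F_iff.2 ⟨(hd.smul l).isCP hφ (hs.smul _) (hT.smul hl), hs.smul _, _, hT.smul hl,
    hd.smul l, ?_⟩
  convert (hT1.smul hl).add (IsPos.one.smul (sub_nonneg.2 hl1.le)) using 1
  rw [smul_sub, sub_smul, one_smul]
  abel

theorem Idx.mem_F (hφ : φ.DenselyDefined) (σ : K.Idx) : σ.map ∈ K.F := G_subset_F hφ σ.mem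

/-- `l ρ` as an element of `𝓖_φ`. -/
def idxSMul {l : ℝ} (hl : 0 ≤ l) (hl1 : l < 1) {ρ : A →ₗ[ℂ] 𝓜(ℂ, B)} (hρ : ρ ∈ K.F) : K.Idx :=
  ⟨(l : ℂ) • ρ, l, hl, hl1, ρ, hρ, rfl⟩

theorem isStrict_of_mem_F {ρ : A →ₗ[ℂ] 𝓜(ℂ, B)} (hρ : ρ ∈ K.F) : IsStrict ρ :=
  (K.mem_F_iff.1 hρ).2.1

theorem Idx.strictExtension_mono (hφ : φ.DenselyDefined) {a : 𝓜(ℂ, A)} (ha : 0 ≤ a) (b : B)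
    {σ τ : K.Idx} (h : σ ≤ τ) :
    star b * (strictExtension σ.map a).fst b ≤ star b * (strictExtension τ.map a).fst b :=
  IsCP.strictExtension_le h (isStrict_of_mem_F (σ.mem_F hφ)) (isStrict_of_mem_F (τ.mem_F hφ)) ha b

theorem star_mul_strictExtension_idxSMul {l : ℝ} (hl : 0 ≤ l) (hl1 : l < 1)
    {ρ : A →ₗ[ℂ] 𝓜(ℂ, B)} (hρ : ρ ∈ K.F) (a : 𝓜(ℂ, A)) (b : B) :
    star b * (strictExtension (idxSMul hl hl1 hρ).map a).fst b
      = l • (star b * (strictExtension ρ a).fst b) := by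
  rw [← mul_smul_comm, ← Complex.coe_smul]
  exact congrArg (fun m : 𝓜(ℂ, B) => star b * m.fst b)
    (strictExtension_smul (isStrict_of_mem_F hρ) l a)

theorem tendsto_one_sub_inv : Tendsto (fun n : ℕ => 1 - 1 / ((n : ℝ) + 1)) atTop (𝓝 1) := by
  simpa using tendsto_const_nhds.sub (tendsto_one_div_add_atTop_nhds_zero_nat (𝕜 := ℝ))

theorem one_sub_inv_nonneg (n : ℕ) : 0 ≤ 1 - 1 / ((n : ℝ) + 1) := by
  have : 1 / ((n : ℝ) + 1) ≤ 1 := by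
    rw [div_le_one (by positivity)]
    linarith [(Nat.cast_nonneg n : (0 : ℝ) ≤ n)]
  linarith

theorem one_sub_inv_lt_one (n : ℕ) : 1 - 1 / ((n : ℝ) + 1) < 1 :=
  sub_lt_self _ (by positivity)

/-- A limit along `𝓖_φ` dominates all of `𝓕_φ`. -/
theorem strictExtension_le_of_tendsto [CompleteSpace E] (hφ : φ.DenselyDefined) {a : 𝓜(ℂ, A)}
    (ha : 0 ≤ a) {b y : B}
    (hy : Tendsto (fun σ : K.Idx => star b * (strictExtension σ.map a).fst b) atTop (𝓝 y))
    {ρ : A →ₗ[ℂ] 𝓜(ℂ, B)} (hρ : ρ ∈ K.F) : star b * (strictExtension ρ a).fst b ≤ y := by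
  have := K.isDirectedOrder hφ
  -- `ρ` need not lie in `𝓖_φ`, but its multiples by `1 - 1/(n+1)` do, and they tend to `ρ`.
  have h1 : ∀ n : ℕ, (1 - 1 / ((n : ℝ) + 1)) • (star b * (strictExtension ρ a).fst b) ≤ y :=
    fun n => by
      rw [← star_mul_strictExtension_idxSMul (one_sub_inv_nonneg n) (one_sub_inv_lt_one n) hρ]
      exact ge_of_tendsto hy ((eventually_ge_atTop _).mono fun τ hτ =>
        Idx.strictExtension_mono hφ ha b hτ)
  have h2 := tendsto_one_sub_inv.smul_const (star b * (strictExtension ρ a).fst b)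
  rw [one_smul] at h2
  exact le_of_tendsto' h2 h1

/-- The values of the extensions converge strictly along `𝓖_φ` on `M̄_φ⁺`. -/
theorem exists_strictTendsto_of_mem_MbarPos [CompleteSpace E] (hφ : φ.DenselyDefined)
    {a : 𝓜(ℂ, A)} (ha : a ∈ K.MbarPos) :
    ∃ m, StrictTendsto (fun σ : K.Idx => strictExtension σ.map a) atTop m := by
  have := K.isDirectedOrder hφ
  refine exists_strictTendsto_of_monotone (fun σ => isPos_fst fun b => ?_)
    (fun σ τ h => isPos_fst fun b => ?_) ha.2
  · exact (K.mem_F_iff.1 (σ.mem_F hφ)).1.strictExtension_nonneg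
      (isStrict_of_mem_F (σ.mem_F hφ)) ha.1 b
  · change 0 ≤ star b * ((strictExtension τ.map a).fst b - (strictExtension σ.map a).fst b)
    rw [mul_sub, sub_nonneg]
    exact Idx.strictExtension_mono hφ ha.1 b h

/-! ### Comparison of `𝓖_φ` with the truncating net. -/

namespace IsTruncatingNet

variable {I : Type*} [Preorder I] {u : I → 𝓜(ℂ, A)} {S : I → E →L[ℂ] E}
  {ρ : I → A →ₗ[ℂ] 𝓜(ℂ, B)}

/-- The density of `ρᵢ` is `Sᵢ* Sᵢ`. -/
theorem mem_F [CompleteSpace E] (hu : K.IsTruncatingNet u S ρ) (i : I) : ρ i ∈ K.F := by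
  obtain ⟨S', hS', hn⟩ := (hu.S_adjointable i).exists_adjoint
  have hT : IsPos B (S' * S i) := .of_nonneg fun x => by
    change 0 ≤ ip B (S' (S i x)) x
    rw [← star_ip, ← hS', star_ip]
    exact ip_self_nonneg _
  refine K.mem_F_iff.2 ⟨hu.ρ_cp i, hu.ρ_strict i, S' * S i, hT, fun a₁ a₂ b₁ b₂ => ?_,
    hT.one_sub_of_norm_le_one ?_⟩
  · rw [hu.ρ_eq, ← star_ip, hS', star_ip]
    rfl
  · have h1 := hu.norm_S i
    calc ‖S' * S i‖ ≤ ‖S'‖ * ‖S i‖ := norm_mul_le _ _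
      _ ≤ 1 * 1 := mul_le_mul (hn.trans h1) h1 (norm_nonneg _) zero_le_one
      _ = 1 := one_mul 1

/-- `σ(uᵢ* a uᵢ) ≤ ρᵢ(a)` for `σ ∈ 𝓕_φ`. -/
theorem strictExtension_conj_le (hφ : φ.DenselyDefined) (hu : K.IsTruncatingNet u S ρ)
    {σ : A →ₗ[ℂ] 𝓜(ℂ, B)} (hσ : σ ∈ K.F) {a : 𝓜(ℂ, A)} (ha : 0 ≤ a) (i : I) (b : B) :
    star b * (strictExtension σ (star (u i) * a * u i)).fst b
      ≤ star b * (strictExtension (ρ i) a).fst b := by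
  obtain ⟨-, hs, T, hT, hd, hT1⟩ := K.mem_F_iff.1 hσ
  obtain ⟨l, hl, hl2, hlN⟩ := exists_isApproximateUnit_of_dense hφ.dense_N
  have := hl.neBot
  obtain ⟨x, rfl⟩ := CStarAlgebra.nonneg_iff_eq_star_mul_self.1 ha
  have e : star (u i) * (star x * x) * u i = star (x * u i) * (x * u i) := by
    simp only [star_mul, mul_assoc]
  rw [e]
  -- The approximate unit is taken in `N_φ`, so that `x e` and `x e uᵢ` lie in `N_φ` and the
  -- inequality becomes `T ≤ 1` at the vector `Λ(x e uᵢ) b = Sᵢ Λ(x e) b`.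
  refine le_of_tendsto_of_tendsto
    (((hs.tendsto_strictExtension hl hl2 x (u i)).fst b).const_mul (star b))
    ((((hu.ρ_strict i).tendsto_strictExtension' hl hl2 x).fst b).const_mul (star b))
    (hlN.mono fun e he => ?_)
  have hx := φ.fst_mem_N x he
  have h1 := hd ⟨_, hu.mul_mem i _ hx⟩ ⟨_, hu.mul_mem i _ hx⟩ b b
  have h2 := hu.ρ_eq i ⟨_, hx⟩ ⟨_, hx⟩ b b
  simp only at h1 h2 ⊢
  rw [h1, h2, hu.S_Λ]
  have h3 := hT1.nonneg (K.Λ ⟨_, hu.mul_mem i _ hx⟩ b)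
  rw [sub_apply, ip_sub_left, sub_nonneg] at h3
  exact h3

theorem tendsto_strictExtension_conj (hu : K.IsTruncatingNet u S ρ) {σ : A →ₗ[ℂ] 𝓜(ℂ, B)}
    (hσ : IsStrict σ) (a : 𝓜(ℂ, A)) :
    StrictTendsto (fun i => strictExtension σ (star (u i) * a * u i)) atTop
      (strictExtension σ a) := by
  have h1 : ∀ i, ‖u i‖ ≤ max 1 ‖a‖ := fun i => (hu.norm_u i).trans (le_max_left _ _)
  have h2 : ∀ i, ‖star (u i) * a‖ ≤ max 1 ‖a‖ := fun i => (norm_mul_le _ _).trans <| by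
    rw [norm_star]
    exact (mul_le_of_le_one_left (norm_nonneg a) (hu.norm_u i)).trans (le_max_right _ _)
  have h3 := (hu.u_tendsto.star.mul (n := a) .const (r := max 1 ‖a‖)
    (.of_forall fun i => by rw [norm_star]; exact h1 i) (.of_forall fun _ => le_max_right _ _)).mul
    hu.u_tendsto (.of_forall h2) (.of_forall h1)
  rw [star_one, one_mul, mul_one] at h3
  refine hσ.isStrictExtension.tendsto h3 (r := max 1 ‖a‖) (.of_forall fun i => ?_)
  refine (norm_mul_le _ _).trans ?_
  exact (mul_le_of_le_one_right (norm_nonneg _) (hu.norm_u i)).trans (h2 i)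

/-- If `(b* σ(a) b)` converges along `𝓖_φ`, then `(b* ρᵢ(a) b)` converges to the same limit. -/
theorem tendsto_of_tendsto_idx [CompleteSpace E] [IsDirectedOrder I] [Nonempty I]
    (hφ : φ.DenselyDefined) (hu : K.IsTruncatingNet u S ρ) {a : 𝓜(ℂ, A)} (ha : 0 ≤ a) {b y : B}
    (hy : Tendsto (fun σ : K.Idx => star b * (strictExtension σ.map a).fst b) atTop (𝓝 y)) :
    Tendsto (fun i => star b * (strictExtension (ρ i) a).fst b) atTop (𝓝 y) := by
  have := K.isDirectedOrder hφ
  rw [Metric.tendsto_nhds] at hy ⊢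
  intro ε hε
  obtain ⟨σ, hσ⟩ := (hy ε hε).exists
  have h1 := ((hu.tendsto_strictExtension_conj (isStrict_of_mem_F (σ.mem_F hφ)) a).fst
    b).const_mul (star b)
  filter_upwards [(h1.dist tendsto_const_nhds).eventually (gt_mem_nhds hσ)] with i hi
  refine lt_of_le_of_lt ?_ hi
  rw [dist_comm, dist_comm _ y, dist_eq_norm, dist_eq_norm]
  -- The sandwich is `0 ≤ y - b* ρᵢ(a) b ≤ y - b* σ(uᵢ* a uᵢ) b`, whose right end tends to `y - b*
  -- σ(a) b`, of norm below `ε` by the choice of `σ`.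
  refine CStarAlgebra.norm_le_norm_of_nonneg_of_le ?_ ?_
  · exact sub_nonneg.2 (strictExtension_le_of_tendsto hφ ha (Metric.tendsto_nhds.2 hy) (hu.mem_F i))
  · exact sub_le_sub_left (hu.strictExtension_conj_le hφ (σ.mem_F hφ) ha i b) _

/-- If `(b* ρᵢ(a) b)` converges, then `(b* σ(a) b)` converges along `𝓖_φ` to the same limit. -/
theorem tendsto_idx_of_tendsto [CompleteSpace E] [IsDirectedOrder I] [Nonempty I]
    (hφ : φ.DenselyDefined) (hu : K.IsTruncatingNet u S ρ) {a : 𝓜(ℂ, A)} (ha : 0 ≤ a) {b y : B}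
    (hy : Tendsto (fun i => star b * (strictExtension (ρ i) a).fst b) atTop (𝓝 y)) :
    Tendsto (fun σ : K.Idx => star b * (strictExtension σ.map a).fst b) atTop (𝓝 y) := by
  -- Pass to the limit over `i` in `σ(uᵢ* a uᵢ) ≤ ρᵢ(a)`.
  have hle : ∀ σ : K.Idx, star b * (strictExtension σ.map a).fst b ≤ y := fun σ =>
    le_of_tendsto_of_tendsto' (((hu.tendsto_strictExtension_conj
      (isStrict_of_mem_F (σ.mem_F hφ)) a).fst b).const_mul (star b)) hy
      fun i => hu.strictExtension_conj_le hφ (σ.mem_F hφ) ha i b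
  rw [Metric.tendsto_nhds] at hy ⊢
  intro ε hε
  obtain ⟨i, hi⟩ := (hy ε hε).exists
  have h2 := tendsto_one_sub_inv.smul_const (star b * (strictExtension (ρ i) a).fst b)
  rw [one_smul] at h2
  obtain ⟨n, hn⟩ := ((h2.dist tendsto_const_nhds).eventually (gt_mem_nhds hi)).exists
  -- A single element `(1 - 1/(n+1)) ρᵢ` of `𝓖_φ` already brings the form within `ε` of `y`;
  -- everything above it lies between that form and `y`.
  filter_upwards [eventually_ge_atTop
    (idxSMul (one_sub_inv_nonneg n) (one_sub_inv_lt_one n) (hu.mem_F i))] with σ hσ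
  refine lt_of_le_of_lt ?_ hn
  rw [dist_comm, dist_comm _ y, dist_eq_norm, dist_eq_norm,
    ← star_mul_strictExtension_idxSMul (one_sub_inv_nonneg n) (one_sub_inv_lt_one n) (hu.mem_F i)]
  exact CStarAlgebra.norm_le_norm_of_nonneg_of_le (sub_nonneg.2 (hle σ))
    (sub_le_sub_left (Idx.strictExtension_mono hφ ha b hσ) _)

/-- The net `ρᵢ(a)` need not be increasing. Instead `0 ≤ m - ρᵢ(a) ≤ m` bounds the differences, so
convergence of their forms to `0` is already strict convergence. -/
theorem exists_strictTendsto_of_mem_MbarPos [CompleteSpace E] [IsDirectedOrder I] [Nonempty I]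
    (hφ : φ.DenselyDefined) (hu : K.IsTruncatingNet u S ρ) {a : 𝓜(ℂ, A)} (ha : a ∈ K.MbarPos) :
    ∃ m, StrictTendsto (fun σ : K.Idx => strictExtension σ.map a) atTop m ∧
      StrictTendsto (fun i => strictExtension (ρ i) a) atTop m := by
  obtain ⟨m, hm⟩ := KSGNS.exists_strictTendsto_of_mem_MbarPos hφ ha
  refine ⟨m, hm, ?_⟩
  have hmb : ∀ b, Tendsto (fun σ : K.Idx => star b * (strictExtension σ.map a).fst b) atTop
      (𝓝 (star b * m.fst b)) := fun b => (hm.fst b).const_mul _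
  have hp : ∀ i, IsPos B (strictExtension (ρ i) a).fst := fun i => isPos_fst fun b =>
    (hu.ρ_cp i).strictExtension_nonneg (hu.ρ_strict i) ha.1 b
  have hp' : ∀ i, IsPos B (m - strictExtension (ρ i) a).fst := fun i => isPos_fst fun b => by
    change 0 ≤ star b * (m.fst b - (strictExtension (ρ i) a).fst b)
    rw [mul_sub, sub_nonneg]
    exact strictExtension_le_of_tendsto hφ ha.1 (hmb b) (hu.mem_F i)
  have h0 := strictTendsto_zero_of_isPos_fst (l := atTop) (C := ‖m‖) hp' (fun i => ?_) fun b => ?_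
  · have := (StrictTendsto.const (m := m)).sub h0
    simpa using this
  · rw [← DoubleCentralizer.norm_fst, ← DoubleCentralizer.norm_fst m]
    refine (hp' i).norm_le_norm ?_
    rw [DoubleCentralizer.sub_fst, sub_sub_cancel]
    exact hp i
  · have := (hu.tendsto_of_tendsto_idx hφ ha.1 (hmb b)).const_sub (star b * m.fst b)
    simpa [mul_sub] using this

theorem exists_strictTendsto_of_mem_Mbar [CompleteSpace E] [IsDirectedOrder I] [Nonempty I]
    (hφ : φ.DenselyDefined) (hu : K.IsTruncatingNet u S ρ) {a : 𝓜(ℂ, A)} (ha : a ∈ K.Mbar) :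
    ∃ m, StrictTendsto (fun σ : K.Idx => strictExtension σ.map a) atTop m ∧
      StrictTendsto (fun i => strictExtension (ρ i) a) atTop m := by
  induction ha using Submodule.span_induction with
  | mem a ha => exact hu.exists_strictTendsto_of_mem_MbarPos hφ ha
  | zero => exact ⟨0, by simpa using StrictTendsto.const, by simpa using StrictTendsto.const⟩
  | add x y _ _ hx hy =>
    obtain ⟨m, h1, h2⟩ := hx
    obtain ⟨n, h3, h4⟩ := hy
    exact ⟨m + n, by simpa using h1.add h3, by simpa using h2.add h4⟩
  | smul z x _ hx =>
    obtain ⟨m, h1, h2⟩ := hx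
    exact ⟨z • m, by simpa using h1.smul z, by simpa using h2.smul z⟩

end IsTruncatingNet

end KSGNS

end CStarWeights

end

/-- Let `φ` be a densely defined lower semi-continuous C⋆-valued weight with a KSGNS-construction
`(E, Λ, π)` and a truncating net `(uᵢ)`, so that `φ` is regular. The first conjunct of the second
part says that the value `φ(a)` for `a ∈ M̄_φ` really is the strict limit that defines it. -/
theorem proposition8p2 {A B E I : Type*}
    [NonUnitalCStarAlgebra A] [PartialOrder A] [StarOrderedRing A]
    [NonUnitalCStarAlgebra B] [PartialOrder B] [StarOrderedRing B]
    [NormedAddCommGroup E] [NormedSpace ℂ E] [SMul Bᵐᵒᵖ E] [CStarModule Bᵐᵒᵖ E] [CompleteSpace E]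
    [Preorder I] [IsDirected I (· ≤ ·)] [Nonempty I]
    (φ : CStarWeights.CStarWeight A B) (K : CStarWeights.KSGNS φ E)
    (hφ : φ.DenselyDefined) (hlsc : K.LowerSemicontinuous)
    (u : I → 𝓜(ℂ, A)) (S : I → E →L[ℂ] E) (ρ : I → A →ₗ[ℂ] 𝓜(ℂ, B))
    (hu : K.IsTruncatingNet u S ρ) :
    (∀ a : 𝓜(ℂ, A), 0 ≤ a →
      (a ∈ K.MbarPos ↔ ∀ b : B, ∃ y : B, Tendsto
        (fun i => star b * (CStarWeights.strictExtension (ρ i) a).fst b) atTop (𝓝 y))) ∧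
    ∀ a ∈ K.Mbar,
      CStarWeights.StrictTendsto
        (fun σ : K.Idx => CStarWeights.strictExtension σ.map a) atTop (K.phiBar a) ∧
      CStarWeights.StrictTendsto
        (fun i => CStarWeights.strictExtension (ρ i) a) atTop (K.phiBar a) := by
  have := K.isDirectedOrder hφ
  refine ⟨fun a ha => ⟨fun h b => ?_, fun h => ⟨ha, fun b => ?_⟩⟩, fun a ha => ?_⟩
  · obtain ⟨y, hy⟩ := h.2 b
    exact ⟨y, hu.tendsto_of_tendsto_idx hφ ha hy⟩
  · obtain ⟨y, hy⟩ := h b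
    exact ⟨y, hu.tendsto_idx_of_tendsto hφ ha hy⟩
  · obtain ⟨m, hm, hm'⟩ := hu.exists_strictTendsto_of_mem_Mbar hφ ha
    -- The value picked by `Classical.epsilon` is meaningful once some limit exists; uniqueness of
    -- strict limits along the directed `𝓖_φ` identifies it with `m`.
    have h : CStarWeights.StrictTendsto
        (fun σ : K.Idx => CStarWeights.strictExtension σ.map a) atTop (K.phiBar a) :=
      Classical.epsilon_spec ⟨m, hm⟩
    exact ⟨h, (h.unique hm) ▸ hm'⟩
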